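/- **Setting.** Let $f$ be a holomorphic diffeomorphism from an open neighborhood of $0$ in $\mathbb{C}^2$ onto an open set, with $f(0)=0$, such that $0$ is an isolated fixed point and $Df_0$ has the eigenvalues $\lambda=e^{2\pi i p/q}$ ($q\ge 1$, $\gcd(p,q)=1$) and $\mu$ with $|\mu|<1$; let $E^c$, $E^s$ be the eigenlines of $\lambda$, $\mu$. Assume that the semi-parabolic multiplicity is $1$: in suitable local holomorphic coordinates at $0$ the map $f$ has the form $(x,y)\mapsto(x_1,y_1)$ with $$x_1=\lambda\bigl(x+x^{q+1}+Cx^{2q+1}+x^{2q+2}r(x,y)\bigr),\qquad y_1=\mu y+x\,h(x,y),$$ where $C$ is a constant and $r,h$ are holomorphic near $0$. Let $B$ be an open ball centered at $0$ and $B'\supset\overline B$ an open set in the domain of $f$ on which $f$ is partially hyperbolic, in the following sense. There are continuous real plane fields $E^s_x,E^c_x$ on $B'$ with $E^s_x\oplus E^c_x=\mathbb{C}^2$, $E^s_0=E^s$, $E^c_0=E^c$, cones $\mathcal C^v_x,\mathcal C^h_x$ of the vectors that make an angle at most $\alpha_v$ with $E^s_x$, respectively at most $\alpha_h$ with $E^c_x$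 (where $0<\alpha_v,\alpha_h<\pi/2$), a continuous Riemannian metric $\|\cdot\|$ on $B'$, and constants $0<|\mu|<\overline\mu<\underline\lambda<1$ such that for all $x\in B'$ with $f(x)\in B'$: $$Df_x(\mathcal C^h_x)\subset \operatorname{Int}\mathcal C^h_{f(x)}\cup\{0\},\qquad Df^{-1}_{f(x)}(\mathcal C^v_{f(x)})\subset\operatorname{Int}\mathcal C^v_x\cup\{0\},$$ $$\underline\lambda\|v\|\le\|Df_x v\|\le\underline\lambda^{-1}\|v\|\ \ (v\in\mathcal C^h_x),\qquad \|Df_xv\|\le\overline\mu\|v\|\ \ (v\in\mathcal C^v_x).$$ Let $\mathcal P$ be the union of those connected components of $$\{x\in B\setminus\{0\}: f^n(x)\in B\ \ \forall n\in\mathbb Z,\ \ f^n(x)\to0\text{ as }n\to\pm\infty\}$$ that contain $0$ in their boundary (the maximal invariant petals relative to $B$), and let $\overline{\mathcal P}$, $\partial\mathcal P$ be the closure and the boundary of $\mathcal P$ in $\mathbb C^2$. A set $H$ is completely invariant if $f$ and $f^{-1}$ are defined on $H$, $f(H)\subset H$ and $f^{-1}(H)\subset H$. A local center manifold relative to $B'$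 is a relatively closed subset of $B'$ of the form $W=\{c+\varphi(c): c\in E^c\cap B'\}\cap B'$ with $\varphi:E^c\cap B'\to E^s$ of class $C^1$, $\varphi(0)=0$, $D\varphi_0=0$, and $f(W)\cap B'\subset W$. **Proposition.** a) The sets $\overline{\mathcal P}$ and $\partial\mathcal P$ are completely invariant, and so is $\overline{\mathcal P}\setminus\mathcal P$. b) The set $\overline{\mathcal P}$ is (non-empty and) connected; it is compact and contained in every local center manifold relative to $B'$. c) The boundary $\partial\mathcal P$ contains no attracting fixed point of $f^q$ (a fixed point at which all eigenvalues of the derivative have modulus $<1$). If there is a local center manifold relative to $B'$, then $\partial\mathcal P$ contains no hyperbolic fixed point of $f^q$ (a fixed point at which no eigenvalue of the derivative has modulus $1$). -/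

import Mathlib

open Filter Topology

noncomputable section

namespace Hedgehog

/-- The complex plane `ℂ²` with its Euclidean norm. -/
abbrev C2 : Type := EuclideanSpace ℂ (Fin 2)

/-- The derivative at `x` as a `ℂ`-linear endomorphism of `ℂ²`. -/
def deriv2 (f : C2 → C2) (x : C2) : Module.End ℂ C2 :=
  (fderiv ℂ f x : C2 →ₗ[ℂ] C2)

/-- The eigenspace of the derivative of `f` at the origin for the number `a`. -/
abbrev eigenline (f : C2 → C2) (a : ℂ) : Submodule ℂ C2 :=
  Module.End.eigenspace (deriv2 f 0) a

/-- A representative, defined on the open set `f.source`, of a germ of holomorphic diffeomorphisms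
of `(ℂ², 0)` with a semi-parabolic fixed point at the origin: the fixed point is isolated, one
eigenvalue is `lam = exp (2 π i p / q)` with `p`, `q` coprime, the other is `mu` with `|mu| < 1`. -/
structure IsSemiParabolicGerm (f : OpenPartialHomeomorph C2 C2) (p : ℤ) (q : ℕ) (lam mu : ℂ) :
    Prop where
  holomorphic : DifferentiableOn ℂ f f.source
  holomorphic_symm : DifferentiableOn ℂ f.symm f.target
  zero_mem : (0 : C2) ∈ f.source
  map_zero : f 0 = 0
  isolated : ∀ᶠ v in 𝓝[≠] (0 : C2), f v ≠ v
  q_pos : 0 < q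
  coprime : IsCoprime p (q : ℤ)
  lam_eq : lam = Complex.exp (2 * Real.pi * Complex.I * ((p : ℂ) / (q : ℂ)))
  hasEigenvalue_lam : Module.End.HasEigenvalue (deriv2 f 0) lam
  hasEigenvalue_mu : Module.End.HasEigenvalue (deriv2 f 0) mu
  norm_mu_lt_one : ‖mu‖ < 1

/-- The semi-parabolic multiplicity of the fixed point `0` is `nu`: there are local holomorphic
coordinates `(x, y) = (Φ v 0, Φ v 1)` at `0` in which `f` has the normal form
`x₁ = lam (x + x ^ (nu q + 1) + C x ^ (2 nu q + 1) + x ^ (2 nu q + 2) r (x, y))`,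
`y₁ = mu y + x h (x, y)` with `r` and `h` holomorphic near `0`. -/
def HasSemiParabolicMultiplicity (f : C2 → C2) (q : ℕ) (lam mu : ℂ) (nu : ℕ) : Prop :=
  1 ≤ nu ∧ ∃ (Φ : OpenPartialHomeomorph C2 C2) (C : ℂ) (r h : C2 → ℂ),
    DifferentiableOn ℂ Φ Φ.source ∧ DifferentiableOn ℂ Φ.symm Φ.target ∧
    (0 : C2) ∈ Φ.source ∧ Φ 0 = 0 ∧ AnalyticAt ℂ r 0 ∧ AnalyticAt ℂ h 0 ∧
    ∀ᶠ v in 𝓝 (0 : C2),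
      Φ (f v) 0 = lam * (Φ v 0 + (Φ v 0) ^ (nu * q + 1) + C * (Φ v 0) ^ (2 * nu * q + 1)
        + (Φ v 0) ^ (2 * nu * q + 2) * r (Φ v)) ∧
      Φ (f v) 1 = mu * Φ v 1 + Φ v 0 * h (Φ v)

/-- The cone of the vectors that make an angle at most `α` with the real subspace `S`
(for `0 < α < π / 2`): the cosine of the angle between `v` and `S` is the quotient of the norm of
the orthogonal projection of `v` to `S` by the norm of `v`. -/
def cone (S : Submodule ℝ C2) (α : ℝ) : Set C2 :=
  {v | Real.cos α * ‖v‖ ≤ ‖S.starProjection v‖}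

/-- A (continuous) Riemannian metric on the set `U`. -/
structure IsRiemannianMetricOn (g : C2 → C2 →L[ℝ] C2 →L[ℝ] ℝ) (U : Set C2) : Prop where
  continuousOn : ContinuousOn g U
  symm : ∀ x ∈ U, ∀ v w : C2, g x v w = g x w v
  pos : ∀ x ∈ U, ∀ v : C2, v ≠ 0 → 0 < g x v v

/-- The length of the tangent vector `v` at `x` for the metric `g`. -/
def metricNorm (g : C2 → C2 →L[ℝ] C2 →L[ℝ] ℝ) (x v : C2) : ℝ :=
  Real.sqrt (g x v v)

/-- The germ `f`, with a fixed point at `0` with eigenvalues `lam` (neutral) and `mu`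
(dissipative), is partially hyperbolic on the open set `U`. The conditions that involve the
tangent space at `f x` are imposed at the points `x` of `U` whose image `f x` is in `U`. -/
def PartiallyHyperbolicOn (f : OpenPartialHomeomorph C2 C2) (lam mu : ℂ) (U : Set C2) : Prop :=
  ∃ (Es Ec : C2 → Submodule ℝ C2) (αv αh muBar lamBar : ℝ) (g : C2 → C2 →L[ℝ] C2 →L[ℝ] ℝ),
    ContinuousOn (fun x => (Es x).starProjection) U ∧
    ContinuousOn (fun x => (Ec x).starProjection) U ∧
    Es 0 = (eigenline f mu).restrictScalars ℝ ∧
    Ec 0 = (eigenline f lam).restrictScalars ℝ ∧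
    (∀ x ∈ U, IsCompl (Es x) (Ec x)) ∧
    (0 < αv ∧ αv < Real.pi / 2) ∧ (0 < αh ∧ αh < Real.pi / 2) ∧
    (0 < ‖mu‖ ∧ ‖mu‖ < muBar ∧ muBar < lamBar ∧ lamBar < 1) ∧
    IsRiemannianMetricOn g U ∧
    ∀ x ∈ U, f x ∈ U →
      (fderiv ℂ f x '' cone (Ec x) αh ⊆ interior (cone (Ec (f x)) αh) ∪ {0}) ∧
      (fderiv ℂ f.symm (f x) '' cone (Es (f x)) αv ⊆ interior (cone (Es x) αv) ∪ {0}) ∧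
      (∀ v ∈ cone (Ec x) αh,
        lamBar * metricNorm g x v ≤ metricNorm g (f x) (fderiv ℂ f x v) ∧
        metricNorm g (f x) (fderiv ℂ f x v) ≤ 1 / lamBar * metricNorm g x v) ∧
      (∀ v ∈ cone (Es x) αv,
        metricNorm g (f x) (fderiv ℂ f x v) ≤ muBar * metricNorm g x v)

/-- `W` is a local center manifold of the fixed point `0` relative to the open set `U`: the part in
`U` of the graph `{c + φ c}` of a `C¹` function `φ` from the neutral eigenline, intersected with
`U`, to the dissipative eigenline, which is tangent to the neutral eigenline at `0`, properly
embedded in `U` (that is, relatively closed in `U`), and locally invariant. -/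
def IsLocalCenterManifold (f : C2 → C2) (lam mu : ℂ) (U W : Set C2) : Prop :=
  ∃ φ : eigenline f lam → eigenline f mu,
    ContDiffOn ℝ 1 φ {c | (c : C2) ∈ U} ∧ φ 0 = 0 ∧ fderiv ℝ φ 0 = 0 ∧
    W = {v | v ∈ U ∧ ∃ c : eigenline f lam, (c : C2) ∈ U ∧ v = (c : C2) + (φ c : C2)} ∧
    closure W ∩ U ⊆ W ∧
    f '' W ∩ U ⊆ W

/-- The points `x ≠ 0` of `B` whose full orbit `(f ^ n x)`, `n ∈ ℤ`, exists, stays in `B` and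
converges to `0` as `n → ∞` and as `n → -∞`. -/
def homoclinicSet (f : C2 → C2) (B : Set C2) : Set C2 :=
  {x | x ∈ B ∧ x ≠ 0 ∧ ∃ u : ℤ → C2, u 0 = x ∧ (∀ n, f (u n) = u (n + 1)) ∧ (∀ n, u n ∈ B) ∧
    Tendsto u atTop (𝓝 0) ∧ Tendsto u atBot (𝓝 0)}

/-- The set of maximal invariant petals relative to `B`: the union of the connected components of
`homoclinicSet f B` which contain `0` in their boundary. -/
def maximalPetals (f : C2 → C2) (B : Set C2) : Set C2 :=
  {x | x ∈ homoclinicSet f B ∧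
    (0 : C2) ∈ frontier (connectedComponentIn (homoclinicSet f B) x)}

/-- Complete invariance: `f` and `f⁻¹` are defined on `H` and map `H` into itself. -/
def IsCompletelyInvariant (f : OpenPartialHomeomorph C2 C2) (H : Set C2) : Prop :=
  H ⊆ f.source ∧ H ⊆ f.target ∧ f '' H ⊆ H ∧ f.symm '' H ⊆ H

/-- An attracting fixed point of `g`: all eigenvalues of the derivative are inside the unit disk. -/
def IsAttractingFixedPoint (g : C2 → C2) (z : C2) : Prop :=
  g z = z ∧ ∀ κ : ℂ, Module.End.HasEigenvalue (deriv2 g z) κ → ‖κ‖ < 1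

/-- A hyperbolic fixed point of `g`: no eigenvalue of the derivative is on the unit circle. -/
def IsHyperbolicFixedPoint (g : C2 → C2) (z : C2) : Prop :=
  g z = z ∧ ∀ κ : ℂ, Module.End.HasEigenvalue (deriv2 g z) κ → ‖κ‖ ≠ 1

end Hedgehog

end

/-!
The argument has three independent parts.

*Invariance.* The map `f` permutes the connected components of the homoclinic set and fixes the
origin, so it maps the union `P` of the components that accumulate at the origin onto itself. As
`closure P` is compact and `f` is a homeomorphism near it, closure and boundary inherit the
invariance. Each component becomes connected with the origin when the origin is added, hence
`closure P` is connected.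

*Existence of petals* (`maximalPetals_nonempty`). In the normal form coordinates a graph transform
(`exists_invariant_graph`, applied to the normal form truncated away from the origin) yields an
invariant Lipschitz graph `y = g x`, on which `f` acts as a parabolic map `G` of one variable,
`G x = lam (x + x ^ (q + 1) + o(x ^ (q + 1)))`. In the coordinate `w = -1 / x ^ q`, in which the
factor `lam` disappears because `lam ^ q = 1`, this is `w ↦ w + q + o(1)`. Therefore half planes
`Re w + Im w > M` are forward invariant, half planes `Im w - Re w > M` are backward invariant, and
the points `w = i s` with `s` large are homoclinic (`exists_homoclinic_ray`). These points form an
arc that ends at the origin, so that this arc lies in one of the components in `P`.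

*Center manifolds and fixed points.* Near the origin `f` contracts the distance to a center manifold
`W` in the direction of the strong stable eigenline. On a backward orbit that tends to the origin
this distance must vanish, so all homoclinic points are in `W`
(`homoclinicSet_subset_of_isLocalCenterManifold`). An attracting fixed point of `f ^ q` in
`closure P` would attract points of `P`, whose orbits tend to the origin; the origin itself is not
attracting. Let `z` be a hyperbolic fixed point in `closure P`. The tangent planes of `W` along `P`
lie in the neutral cones, since they do so near the origin and the cones are forward invariant
(`IsCenterGraph.graphDeriv_mem_cone`). Comparison of the rates in the two cone fields shows that
one eigenvalue at `z` is smaller than the neutral rate and that `W` is tangent at `z` to the other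
eigenline, whose eigenvalue has modulus larger than one since `z` is not attracting. So the inverse
of `f ^ q` contracts `W` towards `z`, and backward orbits of points of `P` close to `z` tend to `z`
and not to the origin (`not_isHyperbolicFixedPoint`).
-/

namespace Hedgehog

/-! ### The maximal petals as an invariant set -/

section Petals

variable {f : OpenPartialHomeomorph C2 C2} {B : Set C2}

lemma homoclinicSet_subset : homoclinicSet f B ⊆ B := fun _ hx => hx.1

lemma maximalPetals_subset_homoclinicSet : maximalPetals f B ⊆ homoclinicSet f B :=
  fun _ hx => hx.1

lemma map_mem_homoclinicSet (hB : B ⊆ f.source) (h0 : (0 : C2) ∈ f.source) (hf0 : f 0 = 0)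
    {x : C2} (hx : x ∈ homoclinicSet f B) : f x ∈ homoclinicSet f B := by
  obtain ⟨hxB, hx0, u, hu0, hu, huB, hT, hb⟩ := hx
  have h1 : f x = u 1 := by rw [← hu0, hu 0, zero_add]
  refine ⟨h1 ▸ huB 1, fun h => hx0 (f.injOn (hB hxB) h0 (h.trans hf0.symm)),
    fun n => u (n + 1), ?_, fun n => hu (n + 1), fun n => huB (n + 1), ?_, ?_⟩
  · simpa using h1.symm
  · exact hT.comp (tendsto_atTop_add_const_right _ 1 tendsto_id)
  · exact hb.comp (tendsto_atBot_add_const_right _ 1 tendsto_id)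

lemma exists_preimage_mem_homoclinicSet (hf0 : f 0 = 0)
    {x : C2} (hx : x ∈ homoclinicSet f B) : ∃ y ∈ homoclinicSet f B, f y = x := by
  obtain ⟨hxB, hx0, u, hu0, hu, huB, hT, hb⟩ := hx
  have h1 : f (u (-1)) = x := by rw [hu (-1), ← hu0]; norm_num
  refine ⟨u (-1), ⟨huB _, fun h => hx0 ?_, fun n => u (n + -1), by simp, fun n => ?_,
    fun n => huB _, ?_, ?_⟩, h1⟩
  · rw [← h1, h, hf0]
  · rw [hu]; congr 1; ring
  · exact hT.comp (tendsto_atTop_add_const_right _ (-1) tendsto_id)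
  · exact hb.comp (tendsto_atBot_add_const_right _ (-1) tendsto_id)

lemma homoclinicSet_subset_target (hB : B ⊆ f.source) (hf0 : f 0 = 0) :
    homoclinicSet f B ⊆ f.target := by
  intro x hx
  obtain ⟨y, hy, rfl⟩ := exists_preimage_mem_homoclinicSet hf0 hx
  exact f.map_source (hB hy.1)

lemma symm_mem_homoclinicSet (hB : B ⊆ f.source) (hf0 : f 0 = 0)
    {x : C2} (hx : x ∈ homoclinicSet f B) : f.symm x ∈ homoclinicSet f B := by
  obtain ⟨y, hy, rfl⟩ := exists_preimage_mem_homoclinicSet hf0 hx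
  rwa [f.left_inv (hB hy.1)]

lemma zero_notMem_homoclinicSet : (0 : C2) ∉ homoclinicSet f B := fun h => h.2.1 rfl

lemma zero_mem_frontier_iff {x : C2} :
    (0 : C2) ∈ frontier (connectedComponentIn (homoclinicSet f B) x) ↔
      (0 : C2) ∈ closure (connectedComponentIn (homoclinicSet f B) x) := by
  refine ⟨fun h => h.1, fun h => ⟨h, fun h' => ?_⟩⟩
  exact zero_notMem_homoclinicSet (connectedComponentIn_subset _ _ (interior_subset h'))

/-- A connected subset of the homoclinic set that accumulates at the origin consists of points of
the maximal petals. -/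
lemma subset_maximalPetals_of_isPreconnected {S : Set C2} (hS : IsPreconnected S)
    (hSH : S ⊆ homoclinicSet f B) (h0 : (0 : C2) ∈ closure S) : S ⊆ maximalPetals f B :=
  fun _ hx => ⟨hSH hx, zero_mem_frontier_iff.2
    (closure_mono (hS.subset_connectedComponentIn hx hSH) h0)⟩

/-- A continuous map of the homoclinic set into itself that fixes the origin maps the petals into
petals, because it maps connected components into connected components. -/
lemma mapsTo_maximalPetals {g : C2 → C2} (hg : Set.MapsTo g (homoclinicSet f B) (homoclinicSet f B))
    {U : Set C2} (hgc : ContinuousOn g U) (hU : homoclinicSet f B ⊆ U)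
    (hg0 : ContinuousAt g 0) (h0 : g 0 = 0) :
    Set.MapsTo g (maximalPetals f B) (maximalPetals f B) := by
  intro x hx
  set K := connectedComponentIn (homoclinicSet f B) x
  have hKH : K ⊆ homoclinicSet f B := connectedComponentIn_subset _ _
  have hgK : IsPreconnected (g '' K) :=
    isPreconnected_connectedComponentIn.image g (hgc.mono (hKH.trans hU))
  refine subset_maximalPetals_of_isPreconnected hgK (Set.image_subset_iff.2 fun y hy => hg (hKH hy))
    ?_ (Set.mem_image_of_mem g (mem_connectedComponentIn hx.1))
  have := mem_closure_image hg0 (zero_mem_frontier_iff.1 hx.2)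
  rwa [h0] at this

lemma map_mem_maximalPetals (hB : B ⊆ f.source) (h0 : (0 : C2) ∈ f.source) (hf0 : f 0 = 0)
    {x : C2} (hx : x ∈ maximalPetals f B) : f x ∈ maximalPetals f B :=
  mapsTo_maximalPetals (fun _ h => map_mem_homoclinicSet hB h0 hf0 h) f.continuousOn
    (homoclinicSet_subset.trans hB) (f.continuousAt h0) hf0 hx

lemma symm_mem_maximalPetals (hB : B ⊆ f.source) (h0 : (0 : C2) ∈ f.source) (hf0 : f 0 = 0)
    {x : C2} (hx : x ∈ maximalPetals f B) : f.symm x ∈ maximalPetals f B := by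
  have h0t : (0 : C2) ∈ f.target := by simpa [hf0] using f.map_source h0
  exact mapsTo_maximalPetals (fun _ h => symm_mem_homoclinicSet hB hf0 h) f.continuousOn_symm
    (homoclinicSet_subset_target hB hf0) (f.continuousAt_symm h0t)
    (by simpa [hf0] using f.left_inv h0) hx

lemma maximalPetals_subset_target (hB : B ⊆ f.source) (hf0 : f 0 = 0) :
    maximalPetals f B ⊆ f.target :=
  maximalPetals_subset_homoclinicSet.trans (homoclinicSet_subset_target hB hf0)

/-- The full orbit of a point of the petals consists of points of the petals. -/
lemma exists_orbit_of_mem_maximalPetals (hB : B ⊆ f.source) (h0 : (0 : C2) ∈ f.source)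
    (hf0 : f 0 = 0) {x : C2} (hx : x ∈ maximalPetals f B) :
    ∃ u : ℤ → C2, u 0 = x ∧ (∀ n, f (u n) = u (n + 1)) ∧ (∀ n, u n ∈ maximalPetals f B) ∧
      Tendsto u atTop (𝓝 0) ∧ Tendsto u atBot (𝓝 0) := by
  obtain ⟨u, hu0, hu, huB, hT, hb⟩ := hx.1.2.2
  refine ⟨u, hu0, hu, fun n => ?_, hT, hb⟩
  induction n with
  | zero => rwa [hu0]
  | succ n ih => rw [← hu]; exact map_mem_maximalPetals hB h0 hf0 ih
  | pred n ih =>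
    have : u (-n - 1) = f.symm (u (-n)) := by
      rw [← f.left_inv (hB (huB (-n - 1))), hu]; congr 2; ring
    rw [this]; exact symm_mem_maximalPetals hB h0 hf0 ih

/-- Removing an invariant set `A` from a completely invariant set leaves a completely invariant set.
The set `A` may reach outside of the domain of `f`. -/
lemma IsCompletelyInvariant.diff {H A : Set C2} (hH : IsCompletelyInvariant f H)
    (h1 : ∀ x ∈ A, x ∈ f.source → f x ∈ A) (h2 : ∀ x ∈ A, x ∈ f.target → f.symm x ∈ A) :
    IsCompletelyInvariant f (H \ A) := by
  obtain ⟨hs, ht, hf, hfs⟩ := hH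
  refine ⟨Set.sdiff_subset.trans hs, Set.sdiff_subset.trans ht, ?_, ?_⟩
  · rintro _ ⟨x, hx, rfl⟩
    refine ⟨hf ⟨x, hx.1, rfl⟩, fun h => hx.2 ?_⟩
    simpa [f.left_inv (hs hx.1)] using h2 _ h (f.map_source (hs hx.1))
  · rintro _ ⟨x, hx, rfl⟩
    refine ⟨hfs ⟨x, hx.1, rfl⟩, fun h => hx.2 ?_⟩
    simpa [f.right_inv (ht hx.1)] using h1 _ h (f.map_target (ht hx.1))

/-- The closure of an invariant set with compact closure in the domain is completely invariant:
the image of the closure is compact, hence closed, and so it contains the closure of the image. -/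
lemma isCompletelyInvariant_closure {P : Set C2} (hPc : IsCompact (closure P))
    (hPs : closure P ⊆ f.source) (hPt : P ⊆ f.target) (h1 : ∀ x ∈ P, f x ∈ P)
    (h2 : ∀ x ∈ P, f.symm x ∈ P) : IsCompletelyInvariant f (closure P) := by
  have hc : ContinuousOn f (closure P) := f.continuousOn.mono hPs
  have hsub : closure P ⊆ f '' closure P := by
    refine closure_minimal (fun x hx => ?_) (hPc.image_of_continuousOn hc).isClosed
    exact ⟨f.symm x, subset_closure (h2 x hx), f.right_inv (hPt hx)⟩
  refine ⟨hPs, fun x hx => ?_, ?_, ?_⟩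
  · obtain ⟨y, hy, rfl⟩ := hsub hx
    exact f.map_source (hPs hy)
  · exact hc.image_closure.trans (closure_mono (Set.image_subset_iff.2 h1))
  · rintro _ ⟨x, hx, rfl⟩
    obtain ⟨y, hy, rfl⟩ := hsub hx
    rwa [f.left_inv (hPs hy)]

lemma isCompletelyInvariant_frontier {P : Set C2} (hP : IsCompletelyInvariant f (closure P))
    (h1 : ∀ x ∈ P, f x ∈ P) (h2 : ∀ x ∈ P, f.symm x ∈ P) :
    IsCompletelyInvariant f (frontier P) := by
  refine hP.diff (fun x hx _ => ?_) fun x hx _ => ?_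
  · have ho := f.isOpen_image_of_subset_source isOpen_interior
      ((interior_subset.trans subset_closure).trans hP.1)
    exact interior_maximal (Set.image_subset_iff.2 fun y hy => h1 y (interior_subset hy)) ho
      ⟨x, hx, rfl⟩
  · have ho := f.symm.isOpen_image_of_subset_source isOpen_interior
      ((interior_subset.trans subset_closure).trans hP.2.1)
    exact interior_maximal (Set.image_subset_iff.2 fun y hy => h2 y (interior_subset hy)) ho
      ⟨x, hx, rfl⟩

/-- The closure of the petals is connected, because the origin is a common accumulation
point of the components of the petals. -/
lemma isPreconnected_closure_maximalPetals : IsPreconnected (closure (maximalPetals f B)) := by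
  rcases (maximalPetals f B).eq_empty_or_nonempty with he | ⟨x₀, hx₀⟩
  · simpa [he] using isPreconnected_empty
  set P := maximalPetals f B with hP
  have hmem : ∀ x ∈ P, ∃ K : Set C2, x ∈ K ∧ (0 : C2) ∈ K ∧ K ⊆ insert 0 P ∧ IsPreconnected K := by
    intro x hx
    have hcl := zero_mem_frontier_iff.1 hx.2
    refine ⟨insert 0 (connectedComponentIn (homoclinicSet f B) x),
      Or.inr (mem_connectedComponentIn hx.1), Or.inl rfl, Set.insert_subset_insert ?_, ?_⟩
    · exact subset_maximalPetals_of_isPreconnected isPreconnected_connectedComponentIn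
        (connectedComponentIn_subset _ _) hcl
    · exact isPreconnected_connectedComponentIn.subset_closure (Set.subset_insert _ _)
        (Set.insert_subset hcl subset_closure)
  have h0cl : (0 : C2) ∈ closure P :=
    closure_mono (subset_maximalPetals_of_isPreconnected isPreconnected_connectedComponentIn
      (connectedComponentIn_subset _ _) (zero_mem_frontier_iff.1 hx₀.2))
      (zero_mem_frontier_iff.1 hx₀.2)
  have hins : IsPreconnected (insert 0 P) := by
    refine isPreconnected_of_forall (0 : C2) fun y hy => ?_
    rcases hy with rfl | hy
    · exact ⟨{0}, by simp, rfl, rfl, isPreconnected_singleton⟩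
    · obtain ⟨K, hyK, h0K, hKP, hK⟩ := hmem y hy
      exact ⟨K, hKP, h0K, hyK, hK⟩
  exact hins.subset_closure (Set.insert_subset h0cl subset_closure)
    (closure_mono (Set.subset_insert _ _))

end Petals

/-! ### A Lipschitz invariant graph over the neutral direction -/

section Graph

open BoundedContinuousFunction

/-- A small Lipschitz perturbation of a rotation of the plane is bijective, with an expansion
bound. -/
lemma bijective_rotation_add {lam : ℂ} (hlam : ‖lam‖ = 1) {X : ℂ → ℂ} {c : ℝ} (hc0 : 0 ≤ c)
    (hc : c < 1) (hX : ∀ x x', ‖X x - X x'‖ ≤ c * ‖x - x'‖) :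
    Function.Bijective (fun x => lam * x + X x) ∧
      ∀ x x', (1 - c) * ‖x - x'‖ ≤ ‖lam * x + X x - (lam * x' + X x')‖ := by
  have hlow : ∀ x x', (1 - c) * ‖x - x'‖ ≤ ‖lam * x + X x - (lam * x' + X x')‖ := by
    intro x x'
    have h1 : lam * (x - x') = (lam * x + X x - (lam * x' + X x')) - (X x - X x') := by ring
    have h2 : ‖x - x'‖ = ‖lam * (x - x')‖ := by rw [norm_mul, hlam, one_mul]
    have h3 := norm_sub_le (lam * x + X x - (lam * x' + X x')) (X x - X x')
    rw [← h1, ← h2] at h3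
    linarith [hX x x']
  have hl0 : lam ≠ 0 := by rintro rfl; simp at hlam
  refine ⟨⟨fun x x' hxx => ?_, fun z => ?_⟩, hlow⟩
  · have h := hlow x x'
    have h0 : lam * x + X x - (lam * x' + X x') = 0 := sub_eq_zero.2 hxx
    rw [h0, norm_zero] at h
    have : ‖x - x'‖ ≤ 0 := by nlinarith [norm_nonneg (x - x')]
    exact sub_eq_zero.1 (norm_le_zero_iff.1 this)
  · -- the preimage of `z` is the fixed point of the contraction `x ↦ lam⁻¹ (z - X x)`
    have hT : ContractingWith ⟨c, hc0⟩ (fun x => lam⁻¹ * (z - X x)) := by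
      refine ⟨hc, LipschitzWith.of_dist_le_mul fun x x' => ?_⟩
      have h1 : lam⁻¹ * (z - X x) - lam⁻¹ * (z - X x') = lam⁻¹ * (X x' - X x) := by ring
      rw [dist_eq_norm, dist_eq_norm, h1, norm_mul, norm_inv, hlam, inv_one, one_mul, norm_sub_rev]
      exact hX x x'
    refine ⟨ContractingWith.fixedPoint _ hT, ?_⟩
    have h := hT.fixedPoint_isFixedPt
    set x := ContractingWith.fixedPoint _ hT
    have h' : lam⁻¹ * (z - X x) = x := h
    have h2 : z - X x = lam * x :=
      (mul_inv_cancel_left₀ hl0 (z - X x)).symm.trans (congrArg (lam * ·) h')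
    change lam * x + X x = z
    rw [← h2]; ring

/-- The graph transform: a global small perturbation of `(x, y) ↦ (lam x, mu y)` with `|lam| = 1`
and `|mu| < 1` has an invariant Lipschitz graph over the first axis, on which it acts
bijectively. -/
theorem exists_invariant_graph {lam mu : ℂ} (hlam : ‖lam‖ = 1) {X Y : ℂ → ℂ → ℂ} {ε H K M : ℝ}
    (hε : 0 ≤ ε) (hK : 0 ≤ K)
    (hX : ∀ x y x' y', ‖X x y - X x' y'‖ ≤ ε * (‖x - x'‖ + ‖y - y'‖))
    (hY : ∀ x y x' y', ‖Y x y - Y x' y'‖ ≤ H * ‖x - x'‖ + ε * ‖y - y'‖)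
    (hYM : ∀ x y, ‖Y x y‖ ≤ M) (hX0 : X 0 0 = 0) (hY0 : Y 0 0 = 0)
    (h1 : ‖mu‖ + ε * (1 + K) < 1)
    (h2 : (‖mu‖ + ε) * K + H ≤ K * (1 - ε * (1 + K))) :
    ∃ g : ℂ → ℂ, g 0 = 0 ∧ (∀ x x', ‖g x - g x'‖ ≤ K * ‖x - x'‖) ∧
      Function.Bijective (fun x => lam * x + X x (g x)) ∧
      (∀ x x', (1 - ε * (1 + K)) * ‖x - x'‖ ≤
        ‖lam * x + X x (g x) - (lam * x' + X x' (g x'))‖) ∧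
      ∀ x, g (lam * x + X x (g x)) = mu * g x + Y x (g x) := by
  set c := ε * (1 + K) with hc
  have hc0 : 0 ≤ c := by positivity
  have hmu := norm_nonneg mu
  have hc1 : c < 1 := by linarith
  have hXg : ∀ g : ℂ → ℂ, (∀ x x', ‖g x - g x'‖ ≤ K * ‖x - x'‖) →
      ∀ x x', ‖X x (g x) - X x' (g x')‖ ≤ c * ‖x - x'‖ := by
    intro g hg x x'
    have := hX x (g x) x' (g x')
    have := mul_le_mul_of_nonneg_left (hg x x') hε
    rw [hc]; nlinarith
  have hbij := fun g (hg : ∀ x x', ‖g x - g x'‖ ≤ K * ‖x - x'‖) =>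
    bijective_rotation_add hlam hc0 hc1 (hXg g hg)
  -- the graph transform acts on the complete space `S` of bounded `K`-Lipschitz functions
  let S : Set (ℂ →ᵇ ℂ) := {g | g 0 = 0 ∧ ∀ x x', ‖g x - g x'‖ ≤ K * ‖x - x'‖}
  have hScl : IsClosed S := by
    have : S = {g : ℂ →ᵇ ℂ | g 0 = 0} ∩ ⋂ x, ⋂ x', {g : ℂ →ᵇ ℂ | ‖g x - g x'‖ ≤ K * ‖x - x'‖} := by
      ext g; simp [S]
    rw [this]
    refine IsClosed.inter (isClosed_eq (continuous_eval_const 0) continuous_const)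
      (isClosed_iInter fun x => isClosed_iInter fun x' => ?_)
    exact isClosed_le ((continuous_eval_const x).sub (continuous_eval_const x')).norm
      continuous_const
  have hex : ∀ g : S, ∃ g' : S, ∀ x, (g' : ℂ →ᵇ ℂ) (lam * x + X x ((g : ℂ →ᵇ ℂ) x)) =
      mu * (g : ℂ →ᵇ ℂ) x + Y x ((g : ℂ →ᵇ ℂ) x) := by
    rintro ⟨g, hg0, hg⟩
    obtain ⟨hb, hlow⟩ := hbij g hg
    let e := Equiv.ofBijective _ hb
    have he : ∀ x, e x = lam * x + X x (g x) := fun x => rfl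
    let g' : ℂ → ℂ := fun z => mu * g (e.symm z) + Y (e.symm z) (g (e.symm z))
    have hg'L : ∀ z z', ‖g' z - g' z'‖ ≤ K * ‖z - z'‖ := by
      intro z z'
      obtain ⟨x, rfl⟩ := e.surjective z
      obtain ⟨x', rfl⟩ := e.surjective z'
      simp only [g', e.symm_apply_apply]
      have e1 : mu * g x + Y x (g x) - (mu * g x' + Y x' (g x')) =
        mu * (g x - g x') + (Y x (g x) - Y x' (g x')) := by ring
      rw [e1]
      have e2 := norm_add_le (mu * (g x - g x')) (Y x (g x) - Y x' (g x'))
      rw [norm_mul] at e2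
      have e3 := hY x (g x) x' (g x')
      have e4 := mul_le_mul_of_nonneg_left (hg x x') (add_nonneg hmu hε)
      have e5 := mul_le_mul_of_nonneg_right h2 (norm_nonneg (x - x'))
      have e6 := mul_le_mul_of_nonneg_left (hlow x x') hK
      rw [he, he]
      linarith
    have hgc : Continuous g' := (LipschitzWith.of_dist_le_mul (K := ⟨K, hK⟩) fun x x' => by
      rw [dist_eq_norm, dist_eq_norm]; exact hg'L x x').continuous
    refine ⟨⟨BoundedContinuousFunction.ofNormedAddCommGroup g' hgc (‖mu‖ * ‖g‖ + M) fun z => ?_,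
      ?_, hg'L⟩, fun x => ?_⟩
    · refine (norm_add_le _ _).trans (add_le_add ?_ (hYM _ _))
      rw [norm_mul]
      exact mul_le_mul_of_nonneg_left (g.norm_coe_le_norm _) hmu
    · have h0 : e 0 = 0 := by rw [he, hg0, hX0]; ring
      have h0' : e.symm 0 = 0 := by rw [← h0, e.symm_apply_apply]; exact h0.symm
      change mu * g (e.symm 0) + Y (e.symm 0) (g (e.symm 0)) = 0
      rw [h0', hg0, hY0]; ring
    · change mu * g (e.symm (e x)) + Y (e.symm (e x)) (g (e.symm (e x))) = _
      rw [e.symm_apply_apply]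
  choose T hT using hex
  have hTc : ContractingWith ⟨‖mu‖ + c, add_nonneg hmu hc0⟩ T := by
    refine ⟨h1, LipschitzWith.of_dist_le_mul fun g k => ?_⟩
    change dist (T g : ℂ →ᵇ ℂ) (T k) ≤ (‖mu‖ + c) * dist (g : ℂ →ᵇ ℂ) k
    set d := dist (g : ℂ →ᵇ ℂ) k with hd
    have hd0 : 0 ≤ d := dist_nonneg
    refine (BoundedContinuousFunction.dist_le (by positivity)).2 fun z => ?_
    -- compare the points of the two graphs that are mapped over the same point `z`
    obtain ⟨x, rfl⟩ := (hbij _ g.2.2).1.2 z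
    rw [dist_eq_norm]
    have hTg := hT g x
    have hTk := hT k x
    have hL := (T k).2.2 (lam * x + X x ((g : ℂ →ᵇ ℂ) x)) (lam * x + X x ((k : ℂ →ᵇ ℂ) x))
    have hgk : ‖(g : ℂ →ᵇ ℂ) x - (k : ℂ →ᵇ ℂ) x‖ ≤ d := by
      rw [← dist_eq_norm]; exact BoundedContinuousFunction.dist_coe_le_dist x
    have hXx := hX x ((g : ℂ →ᵇ ℂ) x) x ((k : ℂ →ᵇ ℂ) x)
    have hYx := hY x ((g : ℂ →ᵇ ℂ) x) x ((k : ℂ →ᵇ ℂ) x)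
    rw [sub_self, norm_zero, zero_add] at hXx
    rw [sub_self, norm_zero, mul_zero, zero_add] at hYx
    set a := (T g : ℂ →ᵇ ℂ) (lam * x + X x ((g : ℂ →ᵇ ℂ) x))
    set b := (T k : ℂ →ᵇ ℂ) (lam * x + X x ((g : ℂ →ᵇ ℂ) x))
    set b' := (T k : ℂ →ᵇ ℂ) (lam * x + X x ((k : ℂ →ᵇ ℂ) x))
    rw [add_sub_add_left_eq_sub] at hL
    have e1 : a - b = mu * ((g : ℂ →ᵇ ℂ) x - (k : ℂ →ᵇ ℂ) x) +
        (Y x ((g : ℂ →ᵇ ℂ) x) - Y x ((k : ℂ →ᵇ ℂ) x)) - (b - b') := by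
      rw [hTg, hTk]; ring
    have e2 : ‖a - b‖ ≤ ‖mu‖ * ‖(g : ℂ →ᵇ ℂ) x - (k : ℂ →ᵇ ℂ) x‖ +
        ‖Y x ((g : ℂ →ᵇ ℂ) x) - Y x ((k : ℂ →ᵇ ℂ) x)‖ + ‖b - b'‖ := by
      rw [e1, ← norm_mul]
      exact (norm_sub_le _ _).trans (add_le_add_left (norm_add_le _ _) _)
    have e3 := mul_le_mul_of_nonneg_left hXx hK
    have e4 := mul_le_mul_of_nonneg_left hgk (add_nonneg hmu hc0)
    change ‖a - b‖ ≤ _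
    rw [hc] at e4 ⊢
    nlinarith
  have : CompleteSpace S := hScl.completeSpace_coe
  have : Nonempty S := ⟨⟨0, by simp, fun x x' => by simpa using by positivity⟩⟩
  have hfix := hTc.fixedPoint_isFixedPt
  set g := ContractingWith.fixedPoint T hTc
  have hfix' : T g = g := hfix
  refine ⟨(g : ℂ →ᵇ ℂ), g.2.1, g.2.2, (hbij _ g.2.2).1, (hbij _ g.2.2).2, fun x => ?_⟩
  have := hT g x
  rwa [hfix'] at this

end Graph

/-! ### One-dimensional parabolic dynamics -/

section Parabolic

/-- A parabolic map `x ↦ lam (x + x ^ (q + 1) (1 + e x))`, with `lam ^ q = 1` and `e x → 0`, is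
close to the translation by `q` in the coordinate `w = -1 / x ^ q`: the displacement of `w` tends to
`q` at the origin. -/
lemma tendsto_fatou_displacement {lam : ℂ} {q : ℕ} (hq : 0 < q) (hlam : lam ^ q = 1) {G e : ℂ → ℂ}
    (he : Tendsto e (𝓝 0) (𝓝 0))
    (hG : ∀ᶠ x in 𝓝 0, G x = lam * (x + x ^ (q + 1) * (1 + e x))) :
    Tendsto (fun x => -1 / G x ^ q - -1 / x ^ q) (𝓝[≠] 0) (𝓝 (q : ℂ)) := by
  -- with `t = x ^ q (1 + e x)` one has `(G x) ^ q = x ^ q (1 + t) ^ q`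
  let φ : ℂ → ℂ := fun t => ((1 + t) ^ q)⁻¹
  have hφ : HasDerivAt φ (-(q : ℂ)) 0 := by
    have h1 : HasDerivAt (fun t : ℂ => (1 + t) ^ q) (q : ℂ) 0 := by
      simpa using ((hasDerivAt_id' (0 : ℂ)).const_add 1).fun_pow q
    simpa using h1.fun_inv (by simp)
  have hD : Tendsto (dslope φ 0) (𝓝 0) (𝓝 (-(q : ℂ))) := by
    have := (continuousAt_dslope_same.2 hφ.differentiableAt).tendsto
    rwa [dslope_same, hφ.deriv] at this
  have ht : Tendsto (fun x : ℂ => x ^ q * (1 + e x)) (𝓝 0) (𝓝 0) := by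
    have h := ((continuous_pow q).tendsto (0 : ℂ)).mul (he.const_add 1)
    simpa [hq.ne'] using h
  have hmain : Tendsto (fun x => -((1 + e x) * dslope φ 0 (x ^ q * (1 + e x)))) (𝓝[≠] 0)
      (𝓝 (q : ℂ)) := by
    have h := ((he.const_add 1).mul (hD.comp ht)).neg
    simp only [add_zero, one_mul, neg_neg] at h
    exact h.mono_left nhdsWithin_le_nhds
  refine hmain.congr' ?_
  filter_upwards [self_mem_nhdsWithin, nhdsWithin_le_nhds hG] with x hx hGx
  have hx0 : x ^ q ≠ 0 := pow_ne_zero _ hx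
  set t := x ^ q * (1 + e x) with htdef
  have hds : t * dslope φ 0 t = φ t - 1 := by
    have := sub_smul_dslope φ 0 t
    simpa [φ] using this
  have hGq : G x ^ q = x ^ q * (1 + t) ^ q := by
    rw [hGx, ← mul_pow, htdef]
    have : lam * (x + x ^ (q + 1) * (1 + e x)) = lam * (x * (1 + x ^ q * (1 + e x))) := by ring
    rw [this, mul_pow, hlam, one_mul]
  have hφt : -1 / G x ^ q = -(φ t) / x ^ q := by
    rw [hGq]; simp only [φ]
    rw [neg_div, neg_div, one_div, mul_inv, div_eq_mul_inv, mul_comm]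
  rw [hφt, div_sub_div_same, eq_div_iff hx0]
  linear_combination -hds

/-- Points with a large image under a linear form in the coordinate `w = -1 / x ^ q` are close to
the origin, and different from it. -/
lemma exists_forall_norm_lt {q : ℕ} (hq : 0 < q) {σ : ℂ → ℝ} (hσ0 : σ 0 = 0)
    (hσ : ∀ w, σ w ≤ 2 * ‖w‖) {η : ℝ} (hη : 0 < η) :
    ∃ M : ℝ, 0 < M ∧ ∀ x : ℂ, M ≤ σ (-1 / x ^ q) → ‖x‖ < η ∧ x ≠ 0 := by
  have hηq : 0 < η ^ q := pow_pos hη q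
  refine ⟨3 / η ^ q, by positivity, fun x hx => ?_⟩
  have hx0 : x ≠ 0 := by
    rintro rfl
    rw [zero_pow hq.ne', div_zero, hσ0] at hx
    exact absurd hx (not_le.2 (by positivity))
  refine ⟨?_, hx0⟩
  have h1 := hx.trans (hσ _)
  rw [norm_div, norm_neg, norm_one, norm_pow] at h1
  have hxq : 0 < ‖x‖ ^ q := pow_pos (norm_pos_iff.2 hx0) q
  have h2 : 3 * ‖x‖ ^ q ≤ 2 * η ^ q := by
    rw [mul_one_div, div_le_div_iff₀ hηq hxq] at h1; exact h1
  exact lt_of_pow_lt_pow_left₀ q hη.le (by linarith)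

/-- If `σ` increases by a definite amount along an orbit as long as it is large, then the orbit
stays where `σ` is large and converges to the origin. -/
lemma tendsto_zero_of_increasing {q : ℕ} (hq : 0 < q) {σ : ℂ → ℝ} (hσ0 : σ 0 = 0)
    (hσ : ∀ w, σ w ≤ 2 * ‖w‖) {c M : ℝ} (hc : 0 < c) {u : ℕ → ℂ}
    (h0 : M ≤ σ (-1 / u 0 ^ q))
    (hu : ∀ n, M ≤ σ (-1 / u n ^ q) → σ (-1 / u n ^ q) + c ≤ σ (-1 / u (n + 1) ^ q)) :
    (∀ n, M ≤ σ (-1 / u n ^ q)) ∧ Tendsto u atTop (𝓝 0) := by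
  have h : ∀ n : ℕ, M + n * c ≤ σ (-1 / u n ^ q) := by
    intro n
    induction n with
    | zero => simpa using h0
    | succ n ih =>
      have := hu n (le_trans (by nlinarith [Nat.cast_nonneg (α := ℝ) n]) ih)
      push_cast
      linarith
  refine ⟨fun n => le_trans (by nlinarith [Nat.cast_nonneg (α := ℝ) n]) (h n), ?_⟩
  rw [Metric.tendsto_atTop]
  intro η hη
  obtain ⟨M', -, hM'⟩ := exists_forall_norm_lt hq hσ0 hσ hη
  obtain ⟨N, hN⟩ := exists_nat_ge ((M' - M) / c)
  refine ⟨N, fun n hn => ?_⟩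
  rw [dist_zero_right]
  refine (hM' _ (le_trans ?_ (h n))).1
  rw [div_le_iff₀ hc] at hN
  have : (N : ℝ) * c ≤ n * c := by gcongr
  linarith

/-- A parabolic map has homoclinic orbits as close to the origin as one likes. The points on the
rays `w = i s`, with `s` large, of the coordinate `w = -1 / x ^ q` have this property: the sets
where `Re w + Im w`, respectively `Im w - Re w`, is large are invariant under the map, respectively
under its inverse. -/
theorem exists_homoclinic_ray {lam : ℂ} {q : ℕ} (hq : 0 < q) (hlam : lam ^ q = 1)
    {G e : ℂ → ℂ} (hGb : Function.Bijective G) {k : ℝ} (hk : 0 < k)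
    (hGk : ∀ x, k * ‖x‖ ≤ ‖G x‖) (he : Tendsto e (𝓝 0) (𝓝 0))
    (hG : ∀ᶠ x in 𝓝 0, G x = lam * (x + x ^ (q + 1) * (1 + e x))) {δ : ℝ} (hδ : 0 < δ) :
    ∃ ζ : ℂ, ζ ≠ 0 ∧ ∃ t₀ : ℝ, 0 < t₀ ∧ ∀ t : ℝ, 0 < t → t < t₀ → ∃ u : ℤ → ℂ,
      u 0 = t * ζ ∧ (∀ n, G (u n) = u (n + 1)) ∧ (∀ n, ‖u n‖ < δ) ∧
      Tendsto u atTop (𝓝 0) ∧ Tendsto u atBot (𝓝 0) := by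
  have hq0 : (0 : ℝ) < q := by exact_mod_cast hq
  have hdisp := tendsto_fatou_displacement hq hlam he hG
  have hdisp' : ∀ᶠ x in 𝓝[≠] (0 : ℂ), ‖-1 / G x ^ q - -1 / x ^ q - q‖ < q / 4 := by
    have := (Metric.tendsto_nhds.1 hdisp) (q / 4) (by positivity)
    simpa [dist_eq_norm] using this
  obtain ⟨δ₁, hδ₁, hd⟩ := Metric.mem_nhdsWithin_iff.1 hdisp'
  replace hd : ∀ x : ℂ, ‖x‖ < δ₁ → x ≠ 0 → ‖-1 / G x ^ q - -1 / x ^ q - q‖ < q / 4 :=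
    fun x hx hx0 => hd ⟨by simpa using hx, hx0⟩
  let σ : ℂ → ℝ := fun w => w.re + w.im
  let τ : ℂ → ℝ := fun w => w.im - w.re
  have hσ0 : σ 0 = 0 := by simp [σ]
  have hτ0 : τ 0 = 0 := by simp [τ]
  have hσ : ∀ w, σ w ≤ 2 * ‖w‖ := fun w => by
    have := Complex.re_le_norm w
    have := (le_abs_self _).trans (Complex.abs_im_le_norm w)
    simp only [σ]; linarith
  have hτ : ∀ w, τ w ≤ 2 * ‖w‖ := fun w => by
    have := (neg_le_abs _).trans (Complex.abs_re_le_norm w)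
    have := (le_abs_self _).trans (Complex.abs_im_le_norm w)
    simp only [τ]; linarith
  have hG0 : G 0 = 0 := by simpa using hG.self_of_nhds
  -- both forms change by at least `q / 2` in the right direction
  have hstep : ∀ x : ℂ, ‖x‖ < δ₁ → x ≠ 0 →
      σ (-1 / x ^ q) + q / 2 ≤ σ (-1 / G x ^ q) ∧ τ (-1 / G x ^ q) + q / 2 ≤ τ (-1 / x ^ q) := by
    intro x hx hx0
    have h := hd x hx hx0
    set v := -1 / G x ^ q - -1 / x ^ q - q with hv
    have hre := (abs_le.1 (Complex.abs_re_le_norm v))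
    have him := (abs_le.1 (Complex.abs_im_le_norm v))
    have e1 : -1 / G x ^ q = -1 / x ^ q + q + v := by rw [hv]; ring
    rw [e1]
    simp only [σ, τ, Complex.add_re, Complex.add_im, Complex.natCast_re, Complex.natCast_im]
    constructor <;> linarith [hre.1, hre.2, him.1, him.2]
  let η := min (min δ δ₁) (k * δ₁)
  have hη : 0 < η := lt_min (lt_min hδ hδ₁) (mul_pos hk hδ₁)
  obtain ⟨M, hM, hMσ⟩ := exists_forall_norm_lt hq hσ0 hσ hη
  obtain ⟨M', hM', hMτ⟩ := exists_forall_norm_lt hq hτ0 hτ hη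
  have hηδ : η ≤ δ := (min_le_left _ _).trans (min_le_left _ _)
  have hηδ₁ : η ≤ δ₁ := (min_le_left _ _).trans (min_le_right _ _)
  have hηk : η ≤ k * δ₁ := min_le_right _ _
  -- the direction of the ray is a `q`-th root of `I`
  obtain ⟨ζ, hζ⟩ := IsAlgClosed.exists_pow_nat_eq Complex.I hq
  have hζ0 : ζ ≠ 0 := by
    rintro rfl
    rw [zero_pow hq.ne'] at hζ
    exact Complex.I_ne_zero hζ.symm
  refine ⟨ζ, hζ0, ?_⟩
  have hlim : ∀ᶠ t : ℝ in 𝓝[>] 0, max M M' ≤ (t ^ q)⁻¹ := by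
    have h1 : Tendsto (fun t : ℝ => t ^ q) (𝓝[>] 0) (𝓝[>] 0) := by
      refine tendsto_nhdsWithin_iff.2 ⟨?_, ?_⟩
      · have := ((continuous_pow q).tendsto (0 : ℝ)).mono_left (nhdsWithin_le_nhds (s := Set.Ioi 0))
        simpa [hq.ne'] using this
      · filter_upwards [self_mem_nhdsWithin] with t ht using pow_pos (Set.mem_Ioi.1 ht) q
    exact (tendsto_inv_nhdsGT_zero.comp h1).eventually_ge_atTop _
  obtain ⟨t₀, ht₀, hlim⟩ := mem_nhdsGT_iff_exists_Ioo_subset.1 hlim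
  refine ⟨t₀, ht₀, fun t ht htt => ?_⟩
  have hs : max M M' ≤ (t ^ q)⁻¹ := hlim ⟨ht, htt⟩
  have hw : -1 / ((t : ℂ) * ζ) ^ q = ((t ^ q)⁻¹ : ℝ) * Complex.I := by
    have : ((t : ℂ)) ^ q ≠ 0 := pow_ne_zero _ (by exact_mod_cast ht.ne')
    rw [mul_pow, hζ]
    push_cast
    field_simp
    simp
  have hwσ : M ≤ σ (-1 / ((t : ℂ) * ζ) ^ q) := by
    have h : σ (((t ^ q)⁻¹ : ℝ) * Complex.I) = (t ^ q)⁻¹ := by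
      simp only [σ, Complex.re_ofReal_mul, Complex.im_ofReal_mul, Complex.I_re, Complex.I_im]
      ring
    rw [hw, h]; exact (le_max_left _ _).trans hs
  have hwτ : M' ≤ τ (-1 / ((t : ℂ) * ζ) ^ q) := by
    have h : τ (((t ^ q)⁻¹ : ℝ) * Complex.I) = (t ^ q)⁻¹ := by
      simp only [τ, Complex.re_ofReal_mul, Complex.im_ofReal_mul, Complex.I_re, Complex.I_im]
      ring
    rw [hw, h]; exact (le_max_right _ _).trans hs
  let E : Equiv.Perm ℂ := Equiv.ofBijective G hGb
  let u : ℤ → ℂ := fun n => (E ^ n) (t * ζ)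
  have hu0 : u 0 = t * ζ := by simp [u]
  have hu : ∀ n, G (u n) = u (n + 1) := by
    intro n
    change E ((E ^ n) (t * ζ)) = (E ^ (n + 1)) (t * ζ)
    rw [add_comm, zpow_add, zpow_one, Equiv.Perm.mul_apply]
  have hpos := tendsto_zero_of_increasing hq hσ0 hσ (c := q / 2) (by positivity)
    (u := fun n : ℕ => u n) (M := M) (by simpa [hu0] using hwσ) fun n hn => by
      obtain ⟨hx, hx0⟩ := hMσ _ hn
      have := (hstep _ (hx.trans_le hηδ₁) hx0).1
      rw [hu] at this
      exact_mod_cast this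
  have hneg := tendsto_zero_of_increasing hq hτ0 hτ (c := q / 2) (by positivity)
    (u := fun n : ℕ => u (-n)) (M := M') (by simpa [hu0] using hwτ) fun n hn => by
      obtain ⟨hx, hx0⟩ := hMτ _ hn
      have e1 : G (u (-((n + 1 : ℕ) : ℤ))) = u (-n) := by rw [hu]; congr 1; push_cast; ring
      have hne : u (-((n + 1 : ℕ) : ℤ)) ≠ 0 := by
        intro h
        rw [h, hG0] at e1
        exact hx0 e1.symm
      have hsm : ‖u (-((n + 1 : ℕ) : ℤ))‖ < δ₁ := by
        have h1 := hGk (u (-((n + 1 : ℕ) : ℤ)))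
        rw [e1] at h1
        exact lt_of_mul_lt_mul_left (h1.trans_lt (hx.trans_le hηk)) hk.le
      have := (hstep _ hsm hne).2
      rwa [e1] at this
  refine ⟨u, hu0, hu, fun n => ?_, ?_, ?_⟩
  · obtain ⟨m, rfl | rfl⟩ := Int.eq_nat_or_neg n
    · exact (hMσ _ (hpos.1 m)).1.trans_le hηδ
    · exact (hMτ _ (hneg.1 m)).1.trans_le hηδ
  · rw [← Nat.map_cast_int_atTop, tendsto_map'_iff]
    exact hpos.2
  · have h1 : Tendsto (fun n : ℤ => u (-n)) atTop (𝓝 0) := by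
      rw [← Nat.map_cast_int_atTop, tendsto_map'_iff]
      exact hneg.2
    have := h1.comp tendsto_neg_atBot_atTop
    simpa [Function.comp_def] using this

end Parabolic

/-! ### Existence of petals -/

section Existence

/-- The point of `ℂ²` with the coordinates `x` and `y`. -/
def pt (x y : ℂ) : C2 := !₂[x, y]

@[simp] lemma pt_zero (x y : ℂ) : pt x y 0 = x := rfl

@[simp] lemma pt_one (x y : ℂ) : pt x y 1 = y := rfl

@[simp] lemma pt_zero_zero : pt 0 0 = 0 := by ext i; fin_cases i <;> rfl

lemma pt_eta (v : C2) : pt (v 0) (v 1) = v := by ext i; fin_cases i <;> rfl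

lemma continuous_pt : Continuous fun z : ℂ × ℂ => pt z.1 z.2 := by
  unfold pt
  fun_prop

lemma norm_pt_le (x y : ℂ) : ‖pt x y‖ ≤ ‖x‖ + ‖y‖ := by
  rw [EuclideanSpace.norm_eq, Fin.sum_univ_two]
  refine Real.sqrt_le_iff.2 ⟨by positivity, ?_⟩
  simp only [pt_zero, pt_one]
  nlinarith [norm_nonneg x, norm_nonneg y]

lemma pt_sub (x y x' y' : ℂ) : pt x y - pt x' y' = pt (x - x') (y - y') := by
  ext i; fin_cases i <;> rfl

/-- Truncation of a complex number to the square of side `2 δ`, a `1`-Lipschitz retraction. -/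
def clamp (δ : ℝ) (z : ℂ) : ℂ := ⟨max (-δ) (min δ z.re), max (-δ) (min δ z.im)⟩

lemma abs_clamp_sub_le (δ a b : ℝ) :
    |max (-δ) (min δ a) - max (-δ) (min δ b)| ≤ |a - b| :=
  (abs_max_sub_max_le_max _ _ _ _).trans (max_le (by simp) ((abs_min_sub_min_le_max _ _ _ _).trans
    (max_le (by simp) le_rfl)))

lemma norm_clamp_sub_le (δ : ℝ) (z z' : ℂ) : ‖clamp δ z - clamp δ z'‖ ≤ ‖z - z'‖ := by
  rw [Complex.norm_eq_sqrt_sq_add_sq, Complex.norm_eq_sqrt_sq_add_sq]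
  refine Real.sqrt_le_sqrt (add_le_add ?_ ?_)
  · exact sq_le_sq.2 (abs_clamp_sub_le δ z.re z'.re)
  · exact sq_le_sq.2 (abs_clamp_sub_le δ z.im z'.im)

lemma clamp_of_norm_le {δ : ℝ} {z : ℂ} (hz : ‖z‖ ≤ δ) : clamp δ z = z := by
  have hr := abs_le.1 ((Complex.abs_re_le_norm z).trans hz)
  have hi := abs_le.1 ((Complex.abs_im_le_norm z).trans hz)
  apply Complex.ext
  · simp [clamp, min_eq_right hr.2, max_eq_right hr.1]
  · simp [clamp, min_eq_right hi.2, max_eq_right hi.1]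

lemma norm_clamp_le {δ : ℝ} (hδ : 0 ≤ δ) (z : ℂ) : ‖clamp δ z‖ ≤ 2 * δ := by
  have h : ∀ a : ℝ, |max (-δ) (min δ a)| ≤ δ := fun a =>
    abs_le.2 ⟨le_max_left _ _, max_le (by linarith) (min_le_left _ _)⟩
  have h1 := Complex.norm_le_abs_re_add_abs_im (clamp δ z)
  have h2 : |(clamp δ z).re| ≤ δ := h z.re
  have h3 : |(clamp δ z).im| ≤ δ := h z.im
  linarith

/-- A function `x k(x, y)` with `k` analytic is, near the origin, Lipschitz in `x` with a constant
close to `|k(0, 0)|` and in `y` with a small constant. -/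
lemma exists_lipschitz_mul {k : C2 → ℂ} (hk : AnalyticAt ℂ k 0) {ε : ℝ} (hε : 0 < ε) :
    ∃ δ > 0, ∀ x y x' y' : ℂ, ‖x‖ < δ → ‖y‖ < δ → ‖x'‖ < δ → ‖y'‖ < δ →
      ‖x * k (pt x y) - x' * k (pt x' y')‖ ≤ (‖k 0‖ + ε) * ‖x - x'‖ + ε * ‖y - y'‖ := by
  have h0 : HasStrictFDerivAt (fun v : C2 => v 0) (EuclideanSpace.proj (0 : Fin 2) : C2 →L[ℂ] ℂ)
      (0 : C2) := (EuclideanSpace.proj (0 : Fin 2) : C2 →L[ℂ] ℂ).hasStrictFDerivAt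
  have h1 : HasStrictFDerivAt (fun v : C2 => v 0 * k v)
      (k 0 • (EuclideanSpace.proj (0 : Fin 2) : C2 →L[ℂ] ℂ)) (0 : C2) := by
    refine (h0.fun_mul hk.hasStrictFDerivAt).congr_fderiv ?_
    refine ContinuousLinearMap.ext fun v => ?_
    change (0 : ℂ) * fderiv ℂ k 0 v + k 0 * v 0 = k 0 * v 0
    rw [zero_mul, zero_add]
  have h2 := (h1.isLittleO.def hε)
  obtain ⟨δ, hδ, h⟩ := Metric.eventually_nhds_iff.1 h2
  refine ⟨δ / 2, by positivity, fun x y x' y' hx hy hx' hy' => ?_⟩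
  have hd : dist (pt x y, pt x' y') ((0 : C2), (0 : C2)) < δ := by
    rw [Prod.dist_eq, dist_zero_right, dist_zero_right]
    exact max_lt ((norm_pt_le _ _).trans_lt (by linarith)) ((norm_pt_le _ _).trans_lt (by linarith))
  have h3 : ‖x * k (pt x y) - x' * k (pt x' y') - k 0 * (x - x')‖ ≤
      ε * ‖pt (x - x') (y - y')‖ := by
    rw [← pt_sub]
    exact h hd
  have h4 := norm_add_le (x * k (pt x y) - x' * k (pt x' y') - k 0 * (x - x')) (k 0 * (x - x'))
  rw [sub_add_cancel, norm_mul] at h4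
  have h5 := mul_le_mul_of_nonneg_left (norm_pt_le (x - x') (y - y')) hε.le
  linarith

/-- A map in the semi-parabolic normal form has an invariant Lipschitz graph over the first axis
near the origin; the action `G` on it extends to a bijection of the plane which has the
one-dimensional parabolic normal form at the origin. -/
lemma exists_invariant_graph_normalForm {lam mu C : ℂ} {q : ℕ} (hq : 0 < q) (hlam : ‖lam‖ = 1)
    (hmu : ‖mu‖ < 1) {r h : C2 → ℂ} (hr : AnalyticAt ℂ r 0) (hh : AnalyticAt ℂ h 0) :
    ∃ (g G e : ℂ → ℂ) (k : ℝ), g 0 = 0 ∧ Continuous g ∧ Function.Bijective G ∧ 0 < k ∧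
      (∀ x, k * ‖x‖ ≤ ‖G x‖) ∧ Tendsto e (𝓝 0) (𝓝 0) ∧
      (∀ᶠ x in 𝓝 0, G x = lam * (x + x ^ (q + 1) * (1 + e x))) ∧
      ∀ᶠ x in 𝓝 0, G x = lam * (x + x ^ (q + 1) + C * x ^ (2 * q + 1) +
        x ^ (2 * q + 2) * r (pt x (g x))) ∧ g (G x) = mu * g x + x * h (pt x (g x)) := by
  set m := ‖mu‖ with hm
  have hm0 : 0 ≤ m := norm_nonneg _
  set a := ‖h 0‖ with ha
  have ha0 : 0 ≤ a := norm_nonneg _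
  have h1m : 0 < 1 - m := by linarith
  -- the constants are chosen such that `K (1 - m) = a + 1` and `ε (1 + K) ^ 2 = (1 - m) / 2`
  set K := (a + 1) / (1 - m) with hKdef
  have hK : 0 < K := by positivity
  have hKm : K * (1 - m) = a + 1 := div_mul_cancel₀ _ h1m.ne'
  set ε := (1 - m) / (2 * (1 + K) ^ 2) with hεdef
  have hε : 0 < ε := by positivity
  have hεK : ε * (1 + K) ^ 2 = (1 - m) / 2 := by rw [hεdef]; field_simp
  let k : C2 → ℂ := fun v => lam * (v 0 ^ q + C * v 0 ^ (2 * q) + v 0 ^ (2 * q + 1) * r v)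
  have hk : AnalyticAt ℂ k 0 := by
    have h0 : AnalyticAt ℂ (fun v : C2 => v 0) 0 :=
      (EuclideanSpace.proj (0 : Fin 2) : C2 →L[ℂ] ℂ).analyticAt 0
    exact analyticAt_const.mul (((h0.pow q).add (analyticAt_const.mul (h0.pow _))).add
      ((h0.pow _).mul hr))
  have hk0 : k 0 = 0 := by simp [k, hq.ne']
  obtain ⟨δ₁, hδ₁, hX⟩ := exists_lipschitz_mul hk hε
  obtain ⟨δ₂, hδ₂, hY⟩ := exists_lipschitz_mul hh hε
  rw [hk0, norm_zero, zero_add] at hX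
  set δ := min δ₁ δ₂ / 3 with hδdef
  have hδ : 0 < δ := by positivity
  have hmin1 : min δ₁ δ₂ ≤ δ₁ := min_le_left _ _
  have hmin2 : min δ₁ δ₂ ≤ δ₂ := min_le_right _ _
  have hc1 : ∀ z, ‖clamp δ z‖ < δ₁ := fun z => (norm_clamp_le hδ.le z).trans_lt (by linarith)
  have hc2 : ∀ z, ‖clamp δ z‖ < δ₂ := fun z => (norm_clamp_le hδ.le z).trans_lt (by linarith)
  have hc0 : clamp δ 0 = 0 := clamp_of_norm_le (by simpa using hδ.le)
  -- the nonlinear terms, truncated: globally Lipschitz and bounded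
  let X : ℂ → ℂ → ℂ := fun x y => clamp δ x * k (pt (clamp δ x) (clamp δ y))
  let Y : ℂ → ℂ → ℂ := fun x y => clamp δ x * h (pt (clamp δ x) (clamp δ y))
  have hXL : ∀ x y x' y', ‖X x y - X x' y'‖ ≤ ε * (‖x - x'‖ + ‖y - y'‖) := by
    intro x y x' y'
    have h1 := hX _ _ _ _ (hc1 x) (hc1 y) (hc1 x') (hc1 y')
    have h2 := mul_le_mul_of_nonneg_left (norm_clamp_sub_le δ x x') hε.le
    have h3 := mul_le_mul_of_nonneg_left (norm_clamp_sub_le δ y y') hε.le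
    exact h1.trans (by linarith)
  have hYL : ∀ x y x' y', ‖Y x y - Y x' y'‖ ≤ (a + ε) * ‖x - x'‖ + ε * ‖y - y'‖ := by
    intro x y x' y'
    have h1 := hY _ _ _ _ (hc2 x) (hc2 y) (hc2 x') (hc2 y')
    have h2 := mul_le_mul_of_nonneg_left (norm_clamp_sub_le δ x x') (add_nonneg ha0 hε.le)
    have h3 := mul_le_mul_of_nonneg_left (norm_clamp_sub_le δ y y') hε.le
    exact h1.trans (by linarith)
  have hYM : ∀ x y, ‖Y x y‖ ≤ (a + ε) * (2 * δ) + ε * (2 * δ) := by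
    intro x y
    have h1 := hY _ _ 0 0 (hc2 x) (hc2 y) (by simpa using hδ₂) (by simpa using hδ₂)
    rw [zero_mul, sub_zero, sub_zero, sub_zero] at h1
    have h2 := mul_le_mul_of_nonneg_left (norm_clamp_le hδ.le x) (add_nonneg ha0 hε.le)
    have h3 := mul_le_mul_of_nonneg_left (norm_clamp_le hδ.le y) hε.le
    exact h1.trans (by linarith)
  obtain ⟨g, hg0, hgL, hb, hlow, hinv⟩ := exists_invariant_graph (lam := lam) (mu := mu) hlam hε.le
    hK.le hXL hYL hYM (by simp [X, hc0]) (by simp [Y, hc0])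
    (by rw [← hm]; nlinarith [mul_pos hε hK, mul_pos (mul_pos hε hK) hK])
    (by rw [← hm]; nlinarith)
  have hgc : Continuous g := (LipschitzWith.of_dist_le_mul (K := ⟨K, hK.le⟩) fun x x' => by
    rw [dist_eq_norm, dist_eq_norm]; exact hgL x x').continuous
  have hsmall : ∀ᶠ x : ℂ in 𝓝 0, ‖x‖ ≤ δ ∧ ‖g x‖ ≤ δ := by
    have h1 : Tendsto (fun x : ℂ => ‖x‖) (𝓝 0) (𝓝 0) := by
      simpa using (continuous_norm (E := ℂ)).tendsto 0
    have h2 : Tendsto (fun x : ℂ => ‖g x‖) (𝓝 0) (𝓝 0) := by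
      simpa [hg0] using hgc.norm.tendsto 0
    exact (h1.eventually_le_const hδ).and (h2.eventually_le_const hδ)
  refine ⟨g, _, fun x => C * x ^ q + x ^ (q + 1) * r (pt x (g x)), 1 - ε * (1 + K), hg0, hgc, hb,
    ?_, fun x => ?_, ?_, ?_, ?_⟩
  · nlinarith [mul_pos hε hK, mul_pos (mul_pos hε hK) hK]
  · have := hlow x 0
    simpa [X, hc0, hg0] using this
  · have h1 : Tendsto (fun x => r (pt x (g x))) (𝓝 0) (𝓝 (r 0)) := by
      have h2 : Tendsto (fun x => pt x (g x)) (𝓝 0) (𝓝 0) := by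
        have := (continuous_pt.comp (continuous_id.prodMk hgc)).tendsto 0
        simpa [Function.comp_def, hg0] using this
      exact hr.continuousAt.tendsto.comp h2
    have h3 := (((continuous_pow q).tendsto (0 : ℂ)).const_mul C).add
      (((continuous_pow (q + 1)).tendsto (0 : ℂ)).mul h1)
    simpa [hq.ne'] using h3
  · filter_upwards [hsmall] with x hx
    simp only [X, k, clamp_of_norm_le hx.1, clamp_of_norm_le hx.2, pt_zero]
    ring
  · filter_upwards [hsmall] with x hx
    constructor
    · simp only [X, k, clamp_of_norm_le hx.1, clamp_of_norm_le hx.2, pt_zero]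
      ring
    · rw [hinv]
      simp only [Y, clamp_of_norm_le hx.1, clamp_of_norm_le hx.2]

variable {f : OpenPartialHomeomorph C2 C2} {p : ℤ} {q : ℕ} {lam mu : ℂ}

lemma IsSemiParabolicGerm.lam_pow (hf : IsSemiParabolicGerm f p q lam mu) : lam ^ q = 1 := by
  have hq : (q : ℂ) ≠ 0 := by exact_mod_cast hf.q_pos.ne'
  rw [hf.lam_eq, ← Complex.exp_nat_mul, Complex.exp_eq_one_iff]
  exact ⟨p, by field_simp⟩

lemma IsSemiParabolicGerm.norm_lam (hf : IsSemiParabolicGerm f p q lam mu) : ‖lam‖ = 1 :=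
  Complex.norm_eq_one_of_pow_eq_one hf.lam_pow hf.q_pos.ne'

/-- The maximal petals are non-empty: the invariant curve of the normal form contains arcs of
homoclinic points that end at the origin. -/
theorem maximalPetals_nonempty (hf : IsSemiParabolicGerm f p q lam mu)
    (hnu : HasSemiParabolicMultiplicity f q lam mu 1) {R : ℝ} (hR : 0 < R) :
    (maximalPetals f (Metric.ball 0 R)).Nonempty := by
  obtain ⟨-, Φ, C, r, h, -, -, h0Φ, hΦ0, hr, hh, hnf⟩ := hnu
  obtain ⟨g, G, e, k, hg0, hgc, hGb, hk, hGk, he, hGe, hG⟩ :=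
    exists_invariant_graph_normalForm (C := C) hf.q_pos hf.norm_lam hf.norm_mu_lt_one hr hh
  have h0t : (0 : C2) ∈ Φ.target := by simpa [hΦ0] using Φ.map_source h0Φ
  have hΦs0 : Φ.symm 0 = 0 := by simpa [hΦ0] using Φ.left_inv h0Φ
  let γ : ℂ → C2 := fun x => pt x (g x)
  have hγ : Continuous γ := continuous_pt.comp (continuous_id.prodMk hgc)
  have hγ0 : γ 0 = 0 := by simp [γ, hg0]
  let v : ℂ → C2 := fun x => Φ.symm (γ x)
  have hv0 : v 0 = 0 := by simp [v, hγ0, hΦs0]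
  have hvc0 : ContinuousAt v 0 := by
    refine ContinuousAt.comp ?_ hγ.continuousAt
    rw [hγ0]; exact Φ.continuousAt_symm h0t
  have hv : Tendsto v (𝓝 0) (𝓝 0) := by simpa [hv0] using hvc0.tendsto
  have hγt : Tendsto γ (𝓝 0) (𝓝 0) := by simpa [hγ0] using hγ.tendsto 0
  have hfv : Tendsto (fun x => f (v x)) (𝓝 0) (𝓝 0) := by
    have := (f.continuousAt hf.zero_mem).tendsto
    rw [hf.map_zero] at this
    exact this.comp hv
  -- near the origin, the curve `v` conjugates `G` to `f`
  have hloc : ∀ᶠ x in 𝓝 0, γ x ∈ Φ.target ∧ v x ∈ Metric.ball (0 : C2) R ∧ f (v x) = v (G x) := by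
    filter_upwards [hγt.eventually (Φ.open_target.mem_nhds h0t),
      hv.eventually (Metric.ball_mem_nhds 0 hR), hfv.eventually (Φ.open_source.mem_nhds h0Φ),
      hv.eventually hnf, hG] with x h1 h2 h3 h4 h5
    refine ⟨h1, h2, ?_⟩
    have h6 : Φ (v x) = γ x := Φ.right_inv h1
    rw [h6] at h4
    have h7 : Φ (f (v x)) = γ (G x) := by
      rw [← pt_eta (Φ (f (v x))), h4.1, h4.2]
      simp only [γ, pt_zero, pt_one, one_mul, mul_one]
      rw [h5.2, ← h5.1]
    rw [← Φ.left_inv h3, h7]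
  obtain ⟨δ, hδ, hloc⟩ := Metric.eventually_nhds_iff.1 hloc
  replace hloc : ∀ x : ℂ, ‖x‖ < δ →
      γ x ∈ Φ.target ∧ v x ∈ Metric.ball (0 : C2) R ∧ f (v x) = v (G x) := fun x hx =>
    hloc (by simpa using hx)
  obtain ⟨ζ, hζ, t₀, ht₀, hray⟩ := exists_homoclinic_ray hf.q_pos hf.lam_pow hGb hk hGk he hGe hδ
  let S : Set C2 := (fun t : ℝ => v (t * ζ)) '' Set.Ioo 0 t₀
  have hcont : ContinuousOn (fun t : ℝ => v (t * ζ)) (Set.Ioo 0 t₀) := by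
    intro t ht
    obtain ⟨u, hu0, -, hu, -⟩ := hray t ht.1 ht.2
    have h1 : ContinuousAt v (t * ζ) :=
      ContinuousAt.comp (Φ.continuousAt_symm (hloc _ (hu0 ▸ hu 0)).1) hγ.continuousAt
    have h2 : ContinuousAt (fun t : ℝ => (t : ℂ) * ζ) t := by fun_prop
    exact (ContinuousAt.comp (f := fun t : ℝ => (t : ℂ) * ζ) h1 h2).continuousWithinAt
  have hSH : S ⊆ homoclinicSet f (Metric.ball 0 R) := by
    rintro _ ⟨t, ht, rfl⟩
    obtain ⟨u, hu0, hu, hus, hT, hB⟩ := hray t ht.1 ht.2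
    have hx := hloc _ (hu0 ▸ hus 0)
    refine ⟨hx.2.1, fun h0 => ?_, fun n => v (u n), congrArg v hu0, fun n => ?_,
      fun n => (hloc _ (hus n)).2.1, hv.comp hT, hv.comp hB⟩
    · have h1 : γ (t * ζ) = 0 := by 
        rw [← Φ.right_inv hx.1, ← hΦ0]; exact congrArg Φ h0
      have h2 : (t : ℂ) * ζ = 0 := congrArg (fun w : C2 => w 0) h1
      exact (mul_ne_zero (by exact_mod_cast ht.1.ne') hζ) h2
    · rw [(hloc _ (hus n)).2.2, hu]
  have hS0 : (0 : C2) ∈ closure S := by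
    have h1 : Tendsto (fun t : ℝ => v (t * ζ)) (𝓝[>] 0) (𝓝 0) := by
      refine hv.comp (tendsto_nhdsWithin_of_tendsto_nhds ?_)
      have : Continuous fun t : ℝ => (t : ℂ) * ζ := by fun_prop
      simpa using this.tendsto 0
    refine mem_closure_of_tendsto h1 ?_
    filter_upwards [Ioo_mem_nhdsGT ht₀] with t ht using ⟨t, ht, rfl⟩
  exact ⟨_, subset_maximalPetals_of_isPreconnected (isPreconnected_Ioo.image _ hcont) hSH hS0
    ⟨t₀ / 2, ⟨by linarith, by linarith⟩, rfl⟩⟩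

end Existence

/-! ### Local center manifolds contain the homoclinic points -/

section CenterManifold

/-- A holomorphic map is strictly differentiable: by the Cauchy estimates, the difference between
the map and its linear part is Lipschitz with a small constant near the base point. -/
lemma hasStrictFDerivAt_of_eventually_differentiableAt {E F : Type*} [NormedAddCommGroup E]
    [NormedSpace ℂ E] [NormedAddCommGroup F] [NormedSpace ℂ F] {f : E → F} {a : E}
    (hf : ∀ᶠ x in 𝓝 a, DifferentiableAt ℂ f x) : HasStrictFDerivAt f (fderiv ℂ f a) a := by
  refine .of_isLittleO (Asymptotics.isLittleO_iff.2 fun η hη => ?_)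
  set L := fderiv ℂ f a with hL
  have h1 : HasFDerivAt f L a := hf.self_of_nhds.hasFDerivAt
  have h2 := h1.isLittleO.def (c := η / 4) (by positivity)
  obtain ⟨ρ, hρ, h⟩ := Metric.eventually_nhds_iff.1 (hf.and h2)
  let N : E → F := fun x => f x - L x
  have hNd : ∀ x, dist x a < ρ → DifferentiableAt ℂ N x := fun x hx =>
    (h hx).1.sub L.differentiableAt
  have hNb : ∀ x, dist x a < ρ → ‖N x - N a‖ ≤ η / 4 * dist x a := by
    intro x hx
    have := (h hx).2
    have e : N x - N a = f x - f a - L (x - a) := by simp only [N, map_sub]; abel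
    rwa [dist_eq_norm, e]
  have hder : ∀ c ∈ Metric.ball a (ρ / 2), ‖fderiv ℂ N c‖ ≤ η := by
    intro c hc
    have hc' : dist c a < ρ / 2 := hc
    have hsub : ∀ x ∈ Metric.ball c (ρ / 2), dist x a < ρ := fun x hx =>
      (dist_triangle x c a).trans_lt (by linarith [Metric.mem_ball.1 hx])
    have := Complex.norm_fderiv_le_div_of_mapsTo_ball (f := N) (c := c) (R₁ := ρ / 2)
      (R₂ := η / 2 * ρ)
      (fun x hx => (hNd x (hsub x hx)).differentiableWithinAt) ?_ (by positivity)
    · refine this.trans (le_of_eq ?_)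
      field_simp
    · intro x hx
      have e1 := hNb x (hsub x hx)
      have e2 := hNb c (by linarith)
      have e3 : N x - N c = (N x - N a) - (N c - N a) := by abel
      rw [Metric.mem_closedBall, dist_eq_norm, e3]
      refine (norm_sub_le _ _).trans ?_
      have e4 := hsub x hx
      nlinarith
  have hnhds : ∀ᶠ p : E × E in 𝓝 (a, a), p.1 ∈ Metric.ball a (ρ / 2) ∧
      p.2 ∈ Metric.ball a (ρ / 2) := by
    have hb := Metric.ball_mem_nhds a (half_pos hρ)
    exact (prod_mem_nhds hb hb)
  filter_upwards [hnhds] with p hp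
  have := (convex_ball a (ρ / 2)).norm_image_sub_le_of_norm_fderiv_le (𝕜 := ℂ) (f := N)
    (fun x hx => hNd x (by linarith [Metric.mem_ball.1 hx])) hder hp.2 hp.1
  have e : N p.1 - N p.2 = f p.1 - f p.2 - L (p.1 - p.2) := by simp only [N, map_sub]; abel
  rwa [e] at this

variable {f : OpenPartialHomeomorph C2 C2} {p : ℤ} {q : ℕ} {lam mu : ℂ}

lemma IsSemiParabolicGerm.differentiableAt (hf : IsSemiParabolicGerm f p q lam mu) {x : C2}
    (hx : x ∈ f.source) : DifferentiableAt ℂ f x :=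
  hf.holomorphic.differentiableAt (f.open_source.mem_nhds hx)

/-- Two different eigenlines in the plane are complementary. -/
lemma isCompl_eigenspace {A : Module.End ℂ C2} {a b : ℂ} (ha : A.HasEigenvalue a)
    (hb : A.HasEigenvalue b) (hab : a ≠ b) : IsCompl (A.eigenspace a) (A.eigenspace b) := by
  have hd : Disjoint (A.eigenspace a) (A.eigenspace b) :=
    A.eigenspaces_iSupIndep.pairwiseDisjoint hab
  refine ⟨hd, codisjoint_iff.2 (Submodule.eq_top_of_finrank_eq ?_)⟩
  have h1 := Submodule.finrank_sup_add_finrank_inf_eq (A.eigenspace a) (A.eigenspace b)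
  rw [disjoint_iff.1 hd, finrank_bot, add_zero] at h1
  have h2 : 0 < Module.finrank ℂ (A.eigenspace a) :=
    Submodule.one_le_finrank_iff.2 ha
  have h3 : 0 < Module.finrank ℂ (A.eigenspace b) :=
    Submodule.one_le_finrank_iff.2 hb
  have h4 : Module.finrank ℂ C2 = 2 := by simp
  have h5 := Submodule.finrank_le (A.eigenspace a ⊔ A.eigenspace b)
  omega

/-- The projections associated with a decomposition of the plane into two complementary
subspaces. -/
lemma exists_projections {S T : Submodule ℂ C2} (h : IsCompl S T) :
    ∃ (πS : C2 →L[ℂ] S) (πT : C2 →L[ℂ] T), (∀ v, (πS v : C2) + πT v = v) ∧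
      (∀ c : S, πS c = c) ∧ (∀ s : T, πS s = 0) ∧ (∀ c : S, πT c = 0) ∧ ∀ s : T, πT s = s :=
  ⟨(S.projectionOnto T h).toContinuousLinearMap, (T.projectionOnto S h.symm).toContinuousLinearMap,
    fun v => by simpa using Submodule.projection_add_projection_eq_self h v,
    fun c => by simp, fun s => by simp, fun c => by simp, fun s => by simp⟩

lemma IsSemiParabolicGerm.isCompl (hf : IsSemiParabolicGerm f p q lam mu) :
    IsCompl (eigenline f lam) (eigenline f mu) :=
  isCompl_eigenspace hf.hasEigenvalue_lam hf.hasEigenvalue_mu fun h => by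
    have := hf.norm_mu_lt_one
    rw [← h, hf.norm_lam] at this
    exact lt_irrefl _ this

/-- The local center manifold `W` relative to `U` as the graph of `φ`, in the coordinates given by
the projections `πc` and `πs` to the two eigenlines of the decomposition of the plane. -/
structure IsCenterGraph (f : C2 → C2) (lam mu : ℂ) (U W : Set C2)
    (πc : C2 →L[ℂ] eigenline f lam) (πs : C2 →L[ℂ] eigenline f mu)
    (φ : eigenline f lam → eigenline f mu) : Prop where
  sum : ∀ v, (πc v : C2) + πs v = v
  c_c : ∀ c : eigenline f lam, πc c = c
  c_s : ∀ s : eigenline f mu, πc s = 0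
  s_c : ∀ c : eigenline f lam, πs c = 0
  s_s : ∀ s : eigenline f mu, πs s = s
  contDiffOn : ContDiffOn ℝ 1 φ {c | (c : C2) ∈ U}
  apply_zero : φ 0 = 0
  fderiv_zero : fderiv ℝ φ 0 = 0
  mem_iff : ∀ v, v ∈ W ↔ v ∈ U ∧ (πc v : C2) ∈ U ∧ πs v = φ (πc v)
  closed : closure W ∩ U ⊆ W
  invariant : f '' W ∩ U ⊆ W

/-- A local center manifold is a graph in the coordinates given by the two eigenlines. -/
lemma IsLocalCenterManifold.exists_graph (hf : IsSemiParabolicGerm f p q lam mu) {U W : Set C2}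
    (hW : IsLocalCenterManifold f lam mu U W) :
    ∃ πc πs φ, IsCenterGraph f lam mu U W πc πs φ := by
  obtain ⟨φ, hφ, hφ0, hφ1, rfl, hcl, hinv⟩ := hW
  obtain ⟨πc, πs, hsum, h1, h2, h3, h4⟩ := exists_projections hf.isCompl
  refine ⟨πc, πs, φ, hsum, h1, h2, h3, h4, hφ, hφ0, hφ1, fun v => ?_, hcl, hinv⟩
  refine and_congr_right fun _ => ⟨?_, fun h => ⟨πc v, h.1, by rw [← h.2, hsum]⟩⟩
  rintro ⟨c, hc, rfl⟩
  have e1 : πc (c + (φ c : C2)) = c := by rw [map_add, h1, h2, add_zero]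
  have e2 : πs (c + (φ c : C2)) = φ c := by rw [map_add, h3, h4, zero_add]
  rw [e1, e2]
  exact ⟨hc, rfl⟩

/-- Every homoclinic point lies on every local center manifold. Near the origin the map contracts
the distance to the manifold along the strong stable direction, so this distance vanishes on the
far past of the orbit; the manifold is forward invariant. -/
theorem homoclinicSet_subset_of_isLocalCenterManifold (hf : IsSemiParabolicGerm f p q lam mu)
    {U B W : Set C2} (hU : IsOpen U) (h0U : (0 : C2) ∈ U) (hBU : B ⊆ U)
    (hW : IsLocalCenterManifold f lam mu U W) : homoclinicSet f B ⊆ W := by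
  obtain ⟨πc, πs, φ, hsum, hcc, hcs, hsc, hss, hφ, hφ0, hφ1, hmem, -, hinv⟩ :=
    hW.exists_graph hf
  have hmu := norm_nonneg mu
  have hmu1 := hf.norm_mu_lt_one
  have hUc : IsOpen {c : eigenline f lam | (c : C2) ∈ U} := hU.preimage continuous_subtype_val
  have hφs : HasStrictFDerivAt φ (0 : eigenline f lam →L[ℝ] eigenline f mu) 0 := by
    rw [← hφ1]
    exact (hφ.contDiffAt (hUc.mem_nhds (by simpa using h0U))).hasStrictFDerivAt one_ne_zero
  have hfs : HasStrictFDerivAt f (fderiv ℂ f 0) 0 :=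
    hasStrictFDerivAt_of_eventually_differentiableAt <| by
      filter_upwards [f.open_source.mem_nhds hf.zero_mem] with x hx using hf.differentiableAt hx
  -- the vertical displacement from the manifold
  let d : C2 → eigenline f mu := fun v => πs v - φ (πc v)
  -- the point of the manifold above the same point of the neutral eigenline
  let v' : C2 → C2 := fun v => (πc v : C2) + φ (πc v)
  have hπc0 : Tendsto πc (𝓝 0) (𝓝 0) := by simpa using πc.continuous.tendsto 0
  have hφc : Tendsto (fun v => φ (πc v)) (𝓝 0) (𝓝 0) := by
    have := hφs.continuousAt.tendsto
    rw [hφ0] at this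
    exact this.comp hπc0
  have hπc0' : Tendsto (fun v => (πc v : C2)) (𝓝 0) (𝓝 0) := by
    simpa [Function.comp_def] using (continuous_subtype_val.comp πc.continuous).tendsto 0
  have hφc' : Tendsto (fun v => (φ (πc v) : C2)) (𝓝 0) (𝓝 0) := by
    simpa [Function.comp_def] using
      (continuous_subtype_val.tendsto (0 : eigenline f mu)).comp hφc
  have hv' : Tendsto v' (𝓝 0) (𝓝 0) := by simpa [v'] using hπc0'.add hφc'
  have hd0 : Tendsto d (𝓝 0) (𝓝 0) := by
    have h1 : Tendsto πs (𝓝 0) (𝓝 0) := by simpa using πs.continuous.tendsto 0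
    simpa [d] using h1.sub hφc
  have hf0 : Tendsto f (𝓝 0) (𝓝 0) := by
    simpa [hf.map_zero] using (f.continuousAt hf.zero_mem).tendsto
  set η : ℝ := (1 - ‖mu‖) / (2 * (‖πs‖ + ‖πc‖ + 1)) with hη
  have hη0 : 0 < η := by have := norm_nonneg πs; have := norm_nonneg πc; positivity
  have hηle : (‖πs‖ + ‖πc‖) * η ≤ (1 - ‖mu‖) / 2 := by
    have h1 : (‖πs‖ + ‖πc‖ + 1) * η = (1 - ‖mu‖) / 2 := by
      rw [hη]; have := norm_nonneg πs; have := norm_nonneg πc; field_simp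
    linarith
  have hcontr : ∀ᶠ v in 𝓝 (0 : C2), ‖d (f v)‖ ≤ (1 + ‖mu‖) / 2 * ‖d v‖ := by
    have hF : ∀ᶠ v in 𝓝 (0 : C2), ‖f v - f (v' v) - fderiv ℂ f 0 (v - v' v)‖ ≤ η * ‖v - v' v‖ :=
      (tendsto_id.prodMk_nhds hv').eventually (hfs.isLittleO.def hη0)
    have hΦ : ∀ᶠ v in 𝓝 (0 : C2), ‖φ (πc (f (v' v))) - φ (πc (f v))‖ ≤
        1 * ‖πc (f (v' v)) - πc (f v)‖ := by
      have h1 := (((hπc0.comp hf0).comp hv').prodMk_nhds (hπc0.comp hf0)).eventually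
        (hφs.isLittleO.def one_pos)
      simpa using h1
    have hv'U := hv'.eventually (hU.mem_nhds h0U)
    have hfv'U := (hf0.comp hv').eventually (hU.mem_nhds h0U)
    have hcU := hπc0'.eventually (hU.mem_nhds h0U)
    filter_upwards [hF, hΦ, hv'U, hfv'U, hcU] with v h1 h2 h3 h4 h5
    have hcv' : πc (v' v) = πc v := by simp only [v', map_add, hcc, hcs, add_zero]
    have hsv' : πs (v' v) = φ (πc v) := by simp only [v', map_add, hsc, hss, zero_add]
    have hv'W : v' v ∈ W := (hmem _).2 ⟨h3, by rwa [hcv'], by rw [hsv', hcv']⟩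
    have hfW : f (v' v) ∈ W := hinv ⟨⟨_, hv'W, rfl⟩, h4⟩
    have hfW' := ((hmem _).1 hfW).2.2
    have hdv : v - v' v = (d v : C2) := by
      have := hsum v
      simp only [v', d, Submodule.coe_sub]
      nth_rewrite 1 [← this]
      abel
    have hDd : fderiv ℂ f 0 (d v : C2) = mu • (d v : C2) :=
      Module.End.mem_eigenspace_iff.1 (d v).2
    rw [hdv, hDd] at h1
    set ω := f v - f (v' v) - mu • (d v : C2) with hω
    have hfv : f v = f (v' v) + mu • (d v : C2) + ω := by rw [hω]; abel
    have e1 : πc (f v) = πc (f (v' v)) + πc ω := by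
      rw [hfv, map_add, map_add, map_smul, hcs, smul_zero, add_zero]
    have e2 : πs (f v) = πs (f (v' v)) + mu • d v + πs ω := by
      rw [hfv, map_add, map_add, map_smul, hss]
    have e3 : d (f v) = mu • d v + πs ω + (φ (πc (f (v' v))) - φ (πc (f v))) := by
      simp only [d]; rw [e2, hfW']; abel
    rw [e1, sub_add_cancel_left, norm_neg, one_mul, ← e1] at h2
    have h1' : ‖ω‖ ≤ η * ‖d v‖ := h1
    have n1 := norm_add₃_le (a := mu • d v) (b := πs ω) (c := φ (πc (f (v' v))) - φ (πc (f v)))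
    rw [← e3, norm_smul] at n1
    have n2 := (πs.le_opNorm ω).trans (mul_le_mul_of_nonneg_left h1' (norm_nonneg πs))
    have n3 := (πc.le_opNorm ω).trans (mul_le_mul_of_nonneg_left h1' (norm_nonneg πc))
    have n4 := mul_le_mul_of_nonneg_right hηle (norm_nonneg (d v))
    linarith
  rintro x ⟨-, -, u, hu0, hu, huB, -, hbot⟩
  set θ := (1 + ‖mu‖) / 2 with hθ
  have hθ0 : 0 ≤ θ := by positivity
  have hθ1 : θ < 1 := by rw [hθ]; linarith
  -- the far past of the orbit is on the manifold
  have hpast : ∀ᶠ n in atBot, u n ∈ W := by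
    have hev := hbot.eventually (hcontr.and
      ((hd0.norm.eventually_le_const (by simp : ‖(0 : eigenline f mu)‖ < 1)).and
        (hπc0'.eventually (hU.mem_nhds h0U))))
    obtain ⟨N, hN⟩ := eventually_atBot.1 hev
    refine eventually_atBot.2 ⟨N, fun n hn => (hmem _).2 ⟨hBU (huB n), (hN n hn).2.2, ?_⟩⟩
    have hk : ∀ k : ℕ, ∀ n ≤ N, ‖d (u n)‖ ≤ θ ^ k := by
      intro k
      induction k with
      | zero => intro n hn; simpa using (hN n hn).2.1
      | succ k ih =>
        intro n hn
        have h1 := (hN (n - 1) (by omega)).1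
        rw [hu, sub_add_cancel] at h1
        rw [pow_succ']
        exact h1.trans (mul_le_mul_of_nonneg_left (ih (n - 1) (by omega)) hθ0)
    have hz : ‖d (u n)‖ ≤ 0 :=
      ge_of_tendsto' (tendsto_pow_atTop_nhds_zero_of_lt_one hθ0 hθ1) fun k => hk k n hn
    exact sub_eq_zero.1 (norm_le_zero_iff.1 hz)
  obtain ⟨N, hN⟩ := eventually_atBot.1 hpast
  have hfor : ∀ k : ℕ, u (N + k) ∈ W := by
    intro k
    induction k with
    | zero => simpa using hN N le_rfl
    | succ k ih =>
      have : u (N + ((k + 1 : ℕ) : ℤ)) = f (u (N + k)) := by rw [hu]; congr 1; push_cast; ring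
      rw [this]
      exact hinv ⟨⟨_, ih, rfl⟩, by rw [← this]; exact hBU (huB _)⟩
  rw [← hu0]
  rcases le_total 0 N with h | h
  · exact hN 0 h
  · have := hfor N.natAbs
    rwa [Int.ofNat_natAbs_of_nonpos h, add_neg_cancel] at this

end CenterManifold

/-! ### Fixed points and spectra of their derivatives -/

section Spectrum

/-- The powers of a linear map of the plane with all eigenvalues in the open unit disk tend to zero,
by Gelfand's formula. -/
lemma tendsto_norm_pow_of_eigenvalues {A : C2 →L[ℂ] C2}
    (hA : ∀ κ : ℂ, Module.End.HasEigenvalue (A : C2 →ₗ[ℂ] C2) κ → ‖κ‖ < 1) :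
    Tendsto (fun n : ℕ => ‖A ^ n‖) atTop (𝓝 0) := by
  have hspec : spectrum ℂ A = spectrum ℂ (A : Module.End ℂ C2) := by
    have := AlgEquiv.spectrum_eq (Module.End.toContinuousLinearMap (𝕜 := ℂ) C2)
      (A : C2 →ₗ[ℂ] C2)
    rw [← this]; congr 1
  have h1 : spectralRadius ℂ A < (1 : NNReal) := by
    refine spectrum.spectralRadius_lt_of_forall_lt A fun z hz => ?_
    rw [hspec] at hz
    exact hA z (Module.End.hasEigenvalue_iff_mem_spectrum.2 hz)
  obtain ⟨ρ, hρ1, hρ2⟩ := ENNReal.lt_iff_exists_nnreal_btwn.1 h1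
  have hρ : (ρ : ℝ) < 1 := by exact_mod_cast hρ2
  have hev :=
    (spectrum.pow_nnnorm_pow_one_div_tendsto_nhds_spectralRadius A).eventually_lt_const hρ1
  refine squeeze_zero' (Eventually.of_forall fun n => norm_nonneg _) ?_
    (tendsto_pow_atTop_nhds_zero_of_lt_one ρ.2 hρ)
  filter_upwards [hev, eventually_gt_atTop 0] with n hn hn0
  have hn' : (0 : ℝ) < n := by exact_mod_cast hn0
  rw [one_div, ENNReal.rpow_inv_lt_iff hn', ENNReal.rpow_natCast] at hn
  have h2 : ‖A ^ n‖₊ < ρ ^ n := by exact_mod_cast hn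
  exact_mod_cast h2.le

/-- Points of an invariant set that are moved closer to `z` by a definite factor, as long as they
are close to `z`, converge to `z` under iteration. -/
lemma tendsto_iterate_of_contracting {k : C2 → C2} {z : C2} {S : Set C2} {c ρ : ℝ} (hc0 : 0 ≤ c)
    (hc : c < 1) (hk : ∀ x ∈ S, dist x z < ρ → k x ∈ S ∧ dist (k x) z ≤ c * dist x z)
    {x : C2} (hx : x ∈ S) (hxρ : dist x z < ρ) : Tendsto (fun j => k^[j] x) atTop (𝓝 z) := by
  have h : ∀ j, k^[j] x ∈ S ∧ dist (k^[j] x) z ≤ c ^ j * dist x z := by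
    intro j
    induction j with
    | zero => simpa using hx
    | succ j ih =>
      have h1 : c ^ j * dist x z ≤ dist x z :=
        mul_le_of_le_one_left dist_nonneg (pow_le_one₀ hc0 hc.le)
      have h2 := hk _ ih.1 (ih.2.trans_lt (h1.trans_lt hxρ))
      rw [Function.iterate_succ_apply', pow_succ', mul_assoc]
      exact ⟨h2.1, h2.2.trans (mul_le_mul_of_nonneg_left ih.2 hc0)⟩
  rw [tendsto_iff_dist_tendsto_zero]
  refine squeeze_zero (fun _ => dist_nonneg) (fun j => (h j).2) ?_
  simpa using (tendsto_pow_atTop_nhds_zero_of_lt_one hc0 hc).mul_const (dist x z)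

variable {f : OpenPartialHomeomorph C2 C2} {p : ℤ} {q : ℕ} {lam mu : ℂ}

/-- The iterates of `f` are differentiable on an invariant set in the domain, with the chain rule
for their derivatives. -/
lemma iterate_mem_and_fderiv_iterate_succ (hf : IsSemiParabolicGerm f p q lam mu) {H : Set C2}
    (hH : H ⊆ f.source) (hHf : ∀ x ∈ H, f x ∈ H) {x : C2} (hx : x ∈ H) (n : ℕ) :
    f^[n] x ∈ H ∧ DifferentiableAt ℂ f^[n] x ∧
      fderiv ℂ f^[n + 1] x = (fderiv ℂ f (f^[n] x)).comp (fderiv ℂ f^[n] x) := by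
  have h1 : ∀ n, f^[n] x ∈ H := by
    intro n
    induction n with
    | zero => exact hx
    | succ n ih => rw [Function.iterate_succ_apply']; exact hHf _ ih
  have h2 : ∀ n, DifferentiableAt ℂ f^[n] x := by
    intro n
    induction n with
    | zero => exact differentiableAt_id
    | succ n ih =>
      rw [Function.iterate_succ']
      exact (hf.differentiableAt (hH (h1 n))).comp x ih
  refine ⟨h1 n, h2 n, ?_⟩
  rw [Function.iterate_succ']
  exact fderiv_comp x (hf.differentiableAt (hH (h1 n))) (h2 n)

/-- The derivative at the origin of the `q`-th iterate has the eigenvalue `lam ^ q = 1`. -/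
lemma hasEigenvalue_one_iterate (hf : IsSemiParabolicGerm f p q lam mu) :
    Module.End.HasEigenvalue (deriv2 f^[q] 0) 1 := by
  have h1 : HasFDerivAt f^[q] ((fderiv ℂ f 0) ^ q) 0 :=
    (hf.differentiableAt hf.zero_mem).hasFDerivAt.iterate hf.map_zero q
  obtain ⟨e, he⟩ := hf.hasEigenvalue_lam.exists_hasEigenvector
  have h2 : ∀ n : ℕ, ((fderiv ℂ f 0) ^ n) e = lam ^ n • e := by
    intro n
    induction n with
    | zero => simp
    | succ n ih =>
      have : fderiv ℂ f 0 e = lam • e := he.apply_eq_smul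
      rw [pow_succ', mul_apply_eq_comp, ih, map_smul, this, smul_smul, ← pow_succ]
  refine Module.End.hasEigenvalue_of_hasEigenvector (x := e)
    ⟨Module.End.mem_eigenspace_iff.2 ?_, he.2⟩
  change fderiv ℂ f^[q] 0 e = (1 : ℂ) • e
  rw [h1.fderiv, h2, hf.lam_pow]

lemma iterate_orbit {u : ℤ → C2} (hu : ∀ n, f (u n) = u (n + 1)) (n : ℕ) :
    f^[n] (u 0) = u n := by
  induction n with
  | zero => simp
  | succ n ih => rw [Function.iterate_succ_apply', ih, hu]; norm_cast

/-- The closure of the petals contains no attracting fixed point of `f ^ q`: it would attract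
points of the petals, whose orbits converge to the origin. -/
theorem not_isAttractingFixedPoint (hf : IsSemiParabolicGerm f p q lam mu) {B : Set C2}
    (hB : B ⊆ f.source) (hH : IsCompletelyInvariant f (closure (maximalPetals f B))) {z : C2}
    (hz : z ∈ closure (maximalPetals f B)) : ¬ IsAttractingFixedPoint f^[q] z := by
  rintro ⟨hzz, hev⟩
  set P := maximalPetals f B with hP
  have hHf : ∀ x ∈ closure P, f x ∈ closure P := fun x hx => hH.2.2.1 ⟨x, hx, rfl⟩
  set A := fderiv ℂ f^[q] z with hA
  have hd : HasFDerivAt f^[q] A z :=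
    (iterate_mem_and_fderiv_iterate_succ hf hH.1 hHf hz q).2.1.hasFDerivAt
  obtain ⟨m, hm0, hm⟩ := (((tendsto_norm_pow_of_eigenvalues hev).eventually_lt_const
    one_half_pos).and (eventually_gt_atTop 0)).exists.imp fun m h => And.intro h.2 h.1
  have hdm : HasFDerivAt (f^[q])^[m] (A ^ m) z := hd.iterate hzz m
  have hzm : (f^[q])^[m] z = z := Function.iterate_fixed hzz m
  rw [← Function.iterate_mul] at hdm hzm
  obtain ⟨ρ, hρ, hcl⟩ := Metric.eventually_nhds_iff.1 (hdm.isLittleO.def (c := 1 / 4) (by norm_num))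
  have hk : ∀ x ∈ (Set.univ : Set C2), dist x z < ρ →
      f^[q * m] x ∈ (Set.univ : Set C2) ∧ dist (f^[q * m] x) z ≤ 3 / 4 * dist x z := by
    intro x _ hx
    refine ⟨trivial, ?_⟩
    have h1 := hcl hx
    rw [hzm] at h1
    have h2 := norm_add_le (f^[q * m] x - z - (A ^ m) (x - z)) ((A ^ m) (x - z))
    rw [sub_add_cancel] at h2
    have h3 := ((A ^ m).le_opNorm (x - z)).trans
      (mul_le_mul_of_nonneg_right hm.le (norm_nonneg _))
    rw [dist_eq_norm, dist_eq_norm]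
    linarith
  obtain ⟨x, hxP, hx⟩ := Metric.mem_closure_iff.1 hz ρ hρ
  rw [dist_comm] at hx
  have hlim := tendsto_iterate_of_contracting (by norm_num) (by norm_num) hk trivial hx
  obtain ⟨u, hu0, hu, -, hT, -⟩ :=
    exists_orbit_of_mem_maximalPetals hB hf.zero_mem hf.map_zero hxP
  have hlim0 : Tendsto (fun j => (f^[q * m])^[j] x) atTop (𝓝 0) := by
    have h1 : (fun j : ℕ => (f^[q * m])^[j] x) = fun j : ℕ => u ((q * m * j : ℕ) : ℤ) := by
      funext j
      rw [← Function.iterate_mul, ← hu0, iterate_orbit hu]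
    rw [h1]
    refine hT.comp (tendsto_natCast_atTop_atTop.comp ?_)
    exact tendsto_id.const_mul_atTop' (Nat.mul_pos hf.q_pos hm0)
  have hz0 : z = 0 := tendsto_nhds_unique hlim hlim0
  rw [hz0] at hev
  have := hev 1 (hasEigenvalue_one_iterate hf)
  simp at this

end Spectrum

/-! ### Growth rates and eigenspaces -/

section Growth

/-- If a vector has preimages under the powers of `A` whose size grows at least like `s ^ (-j)`,
then `A` has an eigenvalue of modulus at most `s`: otherwise `s A⁻¹` has spectral radius less than
one. -/
lemma exists_eigenvalue_norm_le {A : C2 →L[ℂ] C2} {s K : ℝ} (hs : 0 < s) {w : C2} (hw : w ≠ 0)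
    (h : ∀ j : ℕ, ∃ w', (A ^ j) w' = w ∧ ‖w‖ ≤ K * (s ^ j * ‖w'‖)) :
    ∃ κ : ℂ, Module.End.HasEigenvalue (A : C2 →ₗ[ℂ] C2) κ ∧ ‖κ‖ ≤ s := by
  by_contra! hcon
  have hs0 : (s : ℂ) ≠ 0 := by exact_mod_cast hs.ne'
  have hinj : Function.Injective (A : C2 →ₗ[ℂ] C2) := by
    rw [← LinearMap.ker_eq_bot, ← Module.End.eigenspace_zero]
    by_contra hne
    have := hcon 0 hne
    rw [norm_zero] at this
    exact absurd this (not_lt.2 hs.le)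
  let e := LinearEquiv.ofInjectiveEndo (A : C2 →ₗ[ℂ] C2) hinj
  have he : ∀ v, e v = A v := fun v => rfl
  let B : C2 →L[ℂ] C2 := LinearMap.toContinuousLinearMap (e.symm : C2 →ₗ[ℂ] C2)
  have hBA : ∀ v, B (A v) = v := fun v => e.symm_apply_apply v
  have hAB : ∀ v, A (B v) = v := fun v => e.apply_symm_apply v
  have hBAj : ∀ (j : ℕ) v, (B ^ j) ((A ^ j) v) = v := by
    intro j
    induction j with
    | zero => simp
    | succ j ih =>
      intro v
      rw [pow_succ B, pow_succ' A, mul_apply_eq_comp, mul_apply_eq_comp, hBA, ih]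
  have hev : ∀ κ : ℂ, Module.End.HasEigenvalue (((s : ℂ) • B : C2 →L[ℂ] C2) : C2 →ₗ[ℂ] C2) κ →
      ‖κ‖ < 1 := by
    intro κ hκ
    obtain ⟨v, hv⟩ := hκ.exists_hasEigenvector
    have hv1 : (s : ℂ) • B v = κ • v := hv.apply_eq_smul
    have hv2 : (s : ℂ) • v = κ • A v := by rw [← map_smul, ← hv1, map_smul, hAB]
    have hκ0 : κ ≠ 0 := by
      rintro rfl
      rw [zero_smul] at hv2
      exact hv.2 ((smul_eq_zero.1 hv2).resolve_left hs0)
    have h1 : Module.End.HasEigenvalue (A : C2 →ₗ[ℂ] C2) (κ⁻¹ * s) := by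
      refine Module.End.hasEigenvalue_of_hasEigenvector (x := v)
        ⟨Module.End.mem_eigenspace_iff.2 ?_, hv.2⟩
      change A v = (κ⁻¹ * (s : ℂ)) • v
      rw [mul_smul, hv2, smul_smul, inv_mul_cancel₀ hκ0, one_smul]
    have h2 := hcon _ h1
    rw [norm_mul, norm_inv, Complex.norm_real, Real.norm_of_nonneg hs.le] at h2
    have h3 : 0 < ‖κ‖ := norm_pos_iff.2 hκ0
    by_contra! h4
    have h5 : ‖κ‖⁻¹ ≤ 1 := inv_le_one_of_one_le₀ h4
    nlinarith
  have hlim := ((tendsto_norm_pow_of_eigenvalues hev).mul_const ‖w‖).const_mul K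
  rw [zero_mul, mul_zero] at hlim
  have hle : ‖w‖ ≤ 0 := by
    refine ge_of_tendsto' hlim fun j => ?_
    obtain ⟨w', h1, h2⟩ := h j
    have h3 : w' = (B ^ j) w := by rw [← h1, hBAj]
    have hK : 0 < K := by
      have hwpos := norm_pos_iff.2 hw
      by_contra! hK
      have : 0 ≤ s ^ j * ‖w'‖ := by positivity
      nlinarith
    refine h2.trans (mul_le_mul_of_nonneg_left ?_ hK.le)
    have h4 : s ^ j * ‖w'‖ = ‖(((s : ℂ) • B) ^ j) w‖ := by
      rw [smul_pow, smul_apply, norm_smul, norm_pow, Complex.norm_real,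
        Real.norm_of_nonneg hs.le, h3]
    rw [h4]
    exact ContinuousLinearMap.le_opNorm _ _
  exact hw (norm_le_zero_iff.1 hle)

/-- A vector whose preimages under the powers of `A` grow more slowly than those in one eigenspace
lies in the complementary eigenspace. -/
lemma mem_eigenspace_of_slow_growth {A : C2 →L[ℂ] C2} {κ₁ κ₂ : ℂ}
    (hcompl : IsCompl (Module.End.eigenspace (A : C2 →ₗ[ℂ] C2) κ₁)
      (Module.End.eigenspace (A : C2 →ₗ[ℂ] C2) κ₂)) {l K : ℝ} (hl : ‖κ₁‖ < l) {t : C2}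
    (h : ∀ j : ℕ, ∃ t', (A ^ j) t' = t ∧ l ^ j * ‖t'‖ ≤ K) :
    t ∈ Module.End.eigenspace (A : C2 →ₗ[ℂ] C2) κ₂ := by
  obtain ⟨π₁, π₂, hsum, h11, h12, -, -⟩ := exists_projections hcompl
  have hl0 : 0 < l := (norm_nonneg _).trans_lt hl
  have hA1 : ∀ v : Module.End.eigenspace (A : C2 →ₗ[ℂ] C2) κ₁, A v = κ₁ • (v : C2) :=
    fun v => Module.End.mem_eigenspace_iff.1 v.2
  have hA2 : ∀ v : Module.End.eigenspace (A : C2 →ₗ[ℂ] C2) κ₂, A v = κ₂ • (v : C2) :=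
    fun v => Module.End.mem_eigenspace_iff.1 v.2
  have hπA : ∀ v, π₁ (A v) = κ₁ • π₁ v := by
    intro v
    conv_lhs => rw [← hsum v]
    rw [map_add, map_add, hA1, hA2, map_smul, map_smul, h11, h12, smul_zero, add_zero]
  have hπAj : ∀ (j : ℕ) v, π₁ ((A ^ j) v) = κ₁ ^ j • π₁ v := by
    intro j
    induction j with
    | zero => simp
    | succ j ih =>
      intro v
      rw [pow_succ', mul_apply_eq_comp, hπA, ih, smul_smul, ← pow_succ']
  have hlim : Tendsto (fun j : ℕ => (‖κ₁‖ / l) ^ j * (‖π₁‖ * K)) atTop (𝓝 0) := by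
    have := tendsto_pow_atTop_nhds_zero_of_lt_one (div_nonneg (norm_nonneg κ₁) hl0.le)
      ((div_lt_one hl0).2 hl)
    simpa using this.mul_const (‖π₁‖ * K)
  have hle : ‖π₁ t‖ ≤ 0 := by
    refine ge_of_tendsto' hlim fun j => ?_
    obtain ⟨t', h1, h2⟩ := h j
    rw [← h1, hπAj, norm_smul, norm_pow, div_pow, div_mul_eq_mul_div, le_div_iff₀ (pow_pos hl0 j)]
    have h3 := π₁.le_opNorm t'
    have h4 : ‖π₁ t'‖ * l ^ j ≤ ‖π₁‖ * K := by
      have h5 := mul_le_mul_of_nonneg_right h3 (pow_pos hl0 j).le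
      have h6 := mul_le_mul_of_nonneg_left h2 (norm_nonneg π₁)
      linarith
    have := mul_le_mul_of_nonneg_left h4 (pow_nonneg (norm_nonneg κ₁) j)
    linarith
  have h0 : π₁ t = 0 := norm_le_zero_iff.1 hle
  have h2 := hsum t
  rw [h0, Submodule.coe_zero, zero_add] at h2
  rw [← h2]
  exact (π₂ t).2

end Growth

/-! ### Cone fields and metrics -/

section Cones

lemma zero_mem_cone (S : Submodule ℝ C2) (α : ℝ) : (0 : C2) ∈ cone S α := by simp [cone]

lemma interior_cone_union_subset (S : Submodule ℝ C2) (α : ℝ) :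
    interior (cone S α) ∪ {0} ⊆ cone S α :=
  Set.union_subset interior_subset (Set.singleton_subset_iff.2 (zero_mem_cone S α))

lemma mem_cone_of_mem {S : Submodule ℝ C2} (α : ℝ) {v : C2} (hv : v ∈ S) : v ∈ cone S α := by
  change Real.cos α * ‖v‖ ≤ ‖S.starProjection v‖
  rw [Submodule.norm_starProjection_apply S hv]
  exact mul_le_of_le_one_left (norm_nonneg _) (Real.cos_le_one _)

/-- The norm of a continuous Riemannian metric at a point is equivalent to the Euclidean norm. -/
lemma exists_metricNorm_bounds {g : C2 → C2 →L[ℝ] C2 →L[ℝ] ℝ} {U : Set C2}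
    (hg : IsRiemannianMetricOn g U) {z : C2} (hz : z ∈ U) :
    ∃ c C : ℝ, 0 < c ∧ 0 < C ∧
      ∀ v, c * ‖v‖ ≤ metricNorm g z v ∧ metricNorm g z v ≤ C * ‖v‖ := by
  have hcont : Continuous fun v => g z v v := by fun_prop
  obtain ⟨v₀, hv₀, hmin⟩ := (isCompact_sphere (0 : C2) 1).exists_isMinOn
    (NormedSpace.sphere_nonempty.2 zero_le_one) hcont.continuousOn
  have hv₀0 : v₀ ≠ 0 := by
    rintro rfl
    simp at hv₀
  have hpos := hg.pos z hz v₀ hv₀0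
  refine ⟨Real.sqrt (g z v₀ v₀), Real.sqrt (‖g z‖ + 1), Real.sqrt_pos.2 hpos,
    Real.sqrt_pos.2 (by positivity), fun v => ⟨?_, ?_⟩⟩
  · rw [metricNorm, ← Real.sqrt_sq (norm_nonneg v), ← Real.sqrt_mul hpos.le]
    refine Real.sqrt_le_sqrt ?_
    rcases eq_or_ne v 0 with rfl | hv
    · simp
    have hn : ‖v‖ ≠ 0 := norm_ne_zero_iff.2 hv
    have h1 : g z v₀ v₀ ≤ g z (‖v‖⁻¹ • v) (‖v‖⁻¹ • v) := hmin (by simp [norm_smul, hn])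
    simp only [map_smul, smul_apply, smul_eq_mul] at h1
    calc g z v₀ v₀ * ‖v‖ ^ 2 ≤ ‖v‖⁻¹ * (‖v‖⁻¹ * g z v v) * ‖v‖ ^ 2 := by gcongr
      _ = g z v v := by field_simp
  · rw [metricNorm, ← Real.sqrt_sq (norm_nonneg v), ← Real.sqrt_mul (by positivity)]
    refine Real.sqrt_le_sqrt ?_
    have h1 := (le_abs_self _).trans ((g z).le_opNorm₂ v v)
    nlinarith [sq_nonneg ‖v‖]

/-- A continuous field of subspaces on a connected set is non-zero everywhere if it is non-zero at
one point: the norm of the orthogonal projection is zero or one. -/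
lemma ne_bot_of_isPreconnected {E : C2 → Submodule ℝ C2} {K : Set C2} (hK : IsPreconnected K)
    (hE : ContinuousOn (fun x => (E x).starProjection) K) {x₀ x : C2} (hx₀ : x₀ ∈ K)
    (h₀ : E x₀ ≠ ⊥) (hx : x ∈ K) : E x ≠ ⊥ := by
  intro hbot
  have h1 : ‖(E x).starProjection‖ = 0 := by rw [hbot]; simp
  have h2 : ‖(E x₀).starProjection‖ = 1 := (E x₀).norm_starProjection h₀
  obtain ⟨y, -, hy⟩ := hK.intermediate_value hx hx₀ hE.norm
    (show (1 / 2 : ℝ) ∈ Set.Icc ‖(E x).starProjection‖ ‖(E x₀).starProjection‖ by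
      rw [h1, h2]; norm_num)
  change ‖(E y).starProjection‖ = 1 / 2 at hy
  rcases eq_or_ne (E y) ⊥ with hb | hb
  · rw [hb] at hy; simp at hy
  · rw [(E y).norm_starProjection hb] at hy; norm_num at hy

variable {f : OpenPartialHomeomorph C2 C2} {p : ℤ} {q : ℕ} {lam mu : ℂ}

lemma fderiv_symm_comp (hf : IsSemiParabolicGerm f p q lam mu) {x : C2} (hx : x ∈ f.source)
    (v : C2) : fderiv ℂ f.symm (f x) (fderiv ℂ f x v) = v := by
  have h1 := (hf.differentiableAt hx).hasFDerivAt
  have h2 := (hf.holomorphic_symm.differentiableAt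
    (f.open_target.mem_nhds (f.map_source hx))).hasFDerivAt
  have h3 := (h2.comp x h1).congr_of_eventuallyEq (f₁ := id) (by
    filter_upwards [f.open_source.mem_nhds hx] with y hy using (f.left_inv hy).symm)
  exact congrArg (fun L : C2 →L[ℂ] C2 => L v) (h3.unique (hasFDerivAt_id x))

lemma fderiv_comp_symm (hf : IsSemiParabolicGerm f p q lam mu) {x : C2} (hx : x ∈ f.source)
    (v : C2) : fderiv ℂ f x (fderiv ℂ f.symm (f x) v) = v := by
  have hinj : Function.Injective (fderiv ℂ f x : C2 →ₗ[ℂ] C2) :=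
    Function.LeftInverse.injective (fderiv_symm_comp hf hx)
  obtain ⟨w, hw⟩ := LinearMap.injective_iff_surjective.1 hinj v
  have hw' : fderiv ℂ f x w = v := hw
  rw [← hw', fderiv_symm_comp hf hx]

/-- Vectors of the stable cones have preimages in the stable cones under the derivatives of the
iterates, and these preimages are exponentially long. -/
lemma exists_preimage_in_stable_cone (hf : IsSemiParabolicGerm f p q lam mu) {H : Set C2}
    (hH : H ⊆ f.source) (hHf : ∀ x ∈ H, f x ∈ H) {Es : C2 → Submodule ℝ C2} {αv b : ℝ}
    (hb : 0 ≤ b) {g : C2 → C2 →L[ℝ] C2 →L[ℝ] ℝ}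
    (hcone : ∀ x ∈ H,
      fderiv ℂ f.symm (f x) '' cone (Es (f x)) αv ⊆ interior (cone (Es x) αv) ∪ {0})
    (hnorm : ∀ x ∈ H, ∀ v ∈ cone (Es x) αv,
      metricNorm g (f x) (fderiv ℂ f x v) ≤ b * metricNorm g x v)
    {x : C2} (hx : x ∈ H) (n : ℕ) : ∀ v ∈ cone (Es (f^[n] x)) αv, ∃ w ∈ cone (Es x) αv,
      fderiv ℂ f^[n] x w = v ∧ metricNorm g (f^[n] x) v ≤ b ^ n * metricNorm g x w := by
  induction n with
  | zero => intro v hv; exact ⟨v, hv, by simp [Function.iterate_zero], by simp⟩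
  | succ n ih =>
    obtain ⟨hmem, -, hcomp⟩ := iterate_mem_and_fderiv_iterate_succ hf hH hHf hx n
    intro v hv
    rw [Function.iterate_succ_apply'] at hv ⊢
    have hv' := interior_cone_union_subset _ _ (hcone _ hmem ⟨v, hv, rfl⟩)
    obtain ⟨w, hw, hwv, hle⟩ := ih _ hv'
    have hinv := fderiv_comp_symm hf (hH hmem) v
    have h1 := hnorm _ hmem _ hv'
    rw [hinv] at h1
    refine ⟨w, hw, ?_, ?_⟩
    · rw [hcomp, ContinuousLinearMap.comp_apply, hwv, hinv]
    · rw [pow_succ', mul_assoc]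
      exact h1.trans (mul_le_mul_of_nonneg_left hle hb)

/-- The derivatives of the iterates preserve the neutral cones and contract their vectors at most
at the rate `l`. -/
lemma iterate_mem_neutral_cone (hf : IsSemiParabolicGerm f p q lam mu) {H : Set C2}
    (hH : H ⊆ f.source) (hHf : ∀ x ∈ H, f x ∈ H) {Ec : C2 → Submodule ℝ C2} {αh l : ℝ}
    (hl : 0 ≤ l) {g : C2 → C2 →L[ℝ] C2 →L[ℝ] ℝ}
    (hcone : ∀ x ∈ H, fderiv ℂ f x '' cone (Ec x) αh ⊆ interior (cone (Ec (f x)) αh) ∪ {0})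
    (hnorm : ∀ x ∈ H, ∀ v ∈ cone (Ec x) αh,
      l * metricNorm g x v ≤ metricNorm g (f x) (fderiv ℂ f x v))
    {x : C2} (hx : x ∈ H) {v : C2} (hv : v ∈ cone (Ec x) αh) (n : ℕ) :
    fderiv ℂ f^[n] x v ∈ cone (Ec (f^[n] x)) αh ∧
      l ^ n * metricNorm g x v ≤ metricNorm g (f^[n] x) (fderiv ℂ f^[n] x v) := by
  induction n with
  | zero => simpa [Function.iterate_zero] using hv
  | succ n ih =>
    obtain ⟨hmem, -, hcomp⟩ := iterate_mem_and_fderiv_iterate_succ hf hH hHf hx n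
    rw [Function.iterate_succ_apply', hcomp, ContinuousLinearMap.comp_apply]
    refine ⟨interior_cone_union_subset _ _ (hcone _ hmem ⟨_, ih.1, rfl⟩), ?_⟩
    rw [pow_succ', mul_assoc]
    exact (mul_le_mul_of_nonneg_left ih.2 hl).trans (hnorm _ hmem _ ih.1)

end Cones

/-! ### Tangent planes of a local center manifold -/

section Tangent

variable {f : OpenPartialHomeomorph C2 C2} {p : ℤ} {q : ℕ} {lam mu : ℂ} {U W : Set C2}
  {πc : C2 →L[ℂ] eigenline f lam} {πs : C2 →L[ℂ] eigenline f mu}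
  {φ : eigenline f lam → eigenline f mu}

/-- The derivative at `c` of the parametrization `c ↦ c + φ c` of the graph of `φ`; its range is the
tangent plane of the graph. -/
noncomputable def graphDeriv {S T : Submodule ℂ C2} (φ : S → T) (c : S) : S →L[ℝ] C2 :=
  S.subtypeL.restrictScalars ℝ + (T.subtypeL.restrictScalars ℝ).comp (fderiv ℝ φ c)

lemma graphDeriv_apply {S T : Submodule ℂ C2} (φ : S → T) (c v : S) :
    graphDeriv φ c v = (v : C2) + (fderiv ℝ φ c v : C2) := rfl

lemma isOpen_setOf_coe_mem (S : Submodule ℂ C2) (hU : IsOpen U) : IsOpen {c : S | (c : C2) ∈ U} :=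
  hU.preimage continuous_subtype_val

namespace IsCenterGraph

variable (G : IsCenterGraph f lam mu U W πc πs φ)

include G

lemma c_graphDeriv (c v : eigenline f lam) : πc (graphDeriv φ c v) = v := by
  rw [graphDeriv_apply, map_add, G.c_c, G.c_s, add_zero]

lemma hasFDerivAt (hU : IsOpen U) {c : eigenline f lam} (hc : (c : C2) ∈ U) :
    HasFDerivAt φ (fderiv ℝ φ c) c :=
  ((G.contDiffOn.contDiffAt ((isOpen_setOf_coe_mem _ hU).mem_nhds hc)).differentiableAt
    one_ne_zero).hasFDerivAt

lemma hasFDerivAt_graph (hU : IsOpen U) {c : eigenline f lam} (hc : (c : C2) ∈ U) :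
    HasFDerivAt (fun c : eigenline f lam => (c : C2) + (φ c : C2)) (graphDeriv φ c) c :=
  ((eigenline f lam).subtypeL.restrictScalars ℝ).hasFDerivAt.add
    ((((eigenline f mu).subtypeL.restrictScalars ℝ).hasFDerivAt).comp c (G.hasFDerivAt hU hc))

lemma eq_graph {x : C2} (hx : x ∈ W) : x = (πc x : C2) + (φ (πc x) : C2) := by
  rw [← ((G.mem_iff x).1 hx).2.2, G.sum]

lemma continuousAt_graphDeriv (hU : IsOpen U) {x : C2} (hx : (πc x : C2) ∈ U) :
    ContinuousAt (fun x => graphDeriv φ (πc x)) x := by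
  have h1 : ContinuousAt (fderiv ℝ φ) (πc x) :=
    (G.contDiffOn.continuousOn_fderiv_of_isOpen (isOpen_setOf_coe_mem _ hU) le_rfl).continuousAt
      ((isOpen_setOf_coe_mem _ hU).mem_nhds hx)
  have h2 : ContinuousAt (fun x => fderiv ℝ φ (πc x)) x :=
    ContinuousAt.comp (f := πc) h1 πc.continuous.continuousAt
  exact continuousAt_const.add (continuousAt_const.clm_comp h2)

/-- The derivative of `f` maps the tangent planes of the manifold into tangent planes. -/
lemma fderiv_graphDeriv (hf : IsSemiParabolicGerm f p q lam mu) (hU : IsOpen U)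
    {x : C2} (hx : x ∈ W) (hxs : x ∈ f.source) (hfx : f x ∈ U) (v : eigenline f lam) :
    fderiv ℂ f x (graphDeriv φ (πc x) v) =
      graphDeriv φ (πc (f x)) (πc (fderiv ℂ f x (graphDeriv φ (πc x) v))) := by
  have hxc := ((G.mem_iff x).1 hx).2.1
  have hfxW : f x ∈ W := G.invariant ⟨⟨x, hx, rfl⟩, hfx⟩
  have hψ := G.hasFDerivAt_graph hU hxc
  have hfd : HasFDerivAt f ((fderiv ℂ f x).restrictScalars ℝ)
      ((πc x : C2) + (φ (πc x) : C2)) := by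
    rw [← G.eq_graph hx]
    exact (hf.differentiableAt hxs).hasFDerivAt.restrictScalars ℝ
  have hF := hfd.comp (πc x) hψ
  set F : eigenline f lam → C2 := f ∘ fun c : eigenline f lam => (c : C2) + (φ c : C2) with hFdef
  have hFx : F (πc x) = f x := by
    change f ((πc x : C2) + (φ (πc x) : C2)) = f x
    rw [← G.eq_graph hx]
  -- near `πc x`, the image under `f` of the graph satisfies the equation of the graph
  have heq : (fun c => πs (F c)) =ᶠ[𝓝 (πc x)] fun c => φ (πc (F c)) := by
    have h1 := hψ.continuousAt.preimage_mem_nhds (t := U)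
      (hU.mem_nhds (by rw [← G.eq_graph hx]; exact ((G.mem_iff x).1 hx).1))
    have h2 := hF.continuousAt.preimage_mem_nhds (t := U) (hU.mem_nhds (by rwa [hFx]))
    filter_upwards [h1, h2, (isOpen_setOf_coe_mem _ hU).mem_nhds hxc] with c h1 h2 h3
    have hcW : (c : C2) + (φ c : C2) ∈ W := by
      refine (G.mem_iff _).2 ⟨h1, ?_, ?_⟩
      · rwa [map_add, G.c_c, G.c_s, add_zero]
      · rw [map_add, map_add, G.c_c, G.c_s, add_zero, G.s_c, G.s_s, zero_add]
    exact ((G.mem_iff _).1 (G.invariant ⟨⟨_, hcW, rfl⟩, h2⟩)).2.2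
  have hd1 := ((πs.restrictScalars ℝ).hasFDerivAt).comp (πc x) hF
  have hφ' : HasFDerivAt φ (fderiv ℝ φ (πc (f x))) (πc (F (πc x))) := by
    rw [hFx]; exact G.hasFDerivAt hU ((G.mem_iff _).1 hfxW).2.1
  have hd2 := hφ'.comp (πc x) (((πc.restrictScalars ℝ).hasFDerivAt).comp (πc x) hF)
  have hd3 := hd2.congr_of_eventuallyEq heq
  have hd4 : πs (fderiv ℂ f x (graphDeriv φ (πc x) v)) =
      fderiv ℝ φ (πc (f x)) (πc (fderiv ℂ f x (graphDeriv φ (πc x) v))) :=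
    congrArg (fun L : eigenline f lam →L[ℝ] eigenline f mu => L v) (hd1.unique hd3)
  rw [graphDeriv_apply φ (πc (f x)), ← hd4, G.sum]

/-- The derivative of `f` maps the tangent planes of the manifold onto tangent planes. -/
lemma exists_fderiv_graphDeriv_eq (hf : IsSemiParabolicGerm f p q lam mu) (hU : IsOpen U)
    {x : C2} (hx : x ∈ W) (hxs : x ∈ f.source) (hfx : f x ∈ U) (w : eigenline f lam) :
    ∃ v, fderiv ℂ f x (graphDeriv φ (πc x) v) = graphDeriv φ (πc (f x)) w := by
  let L : eigenline f lam →L[ℝ] eigenline f lam :=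
    (πc.restrictScalars ℝ).comp (((fderiv ℂ f x).restrictScalars ℝ).comp (graphDeriv φ (πc x)))
  have hL : ∀ v, L v = πc (fderiv ℂ f x (graphDeriv φ (πc x) v)) := fun v => rfl
  -- an injective endomorphism of the finite-dimensional neutral eigenline is surjective
  have hinj : Function.Injective (L : eigenline f lam →ₗ[ℝ] eigenline f lam) := by
    rw [← LinearMap.ker_eq_bot, LinearMap.ker_eq_bot']
    intro v hv
    have h1 := G.fderiv_graphDeriv hf hU hx hxs hfx v
    rw [← hL, show L v = 0 from hv, map_zero] at h1
    have h2 := fderiv_symm_comp hf hxs (graphDeriv φ (πc x) v)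
    rw [h1, map_zero] at h2
    rw [← G.c_graphDeriv (πc x) v, ← h2, map_zero]
  have : FiniteDimensional ℝ (eigenline f lam) := FiniteDimensional.complexToReal _
  obtain ⟨v, hv⟩ := LinearMap.injective_iff_surjective.1 hinj w
  refine ⟨v, ?_⟩
  rw [G.fderiv_graphDeriv hf hU hx hxs hfx v, ← hL, show L v = w from hv]

lemma exists_fderiv_iterate_graphDeriv_eq (hf : IsSemiParabolicGerm f p q lam mu) (hU : IsOpen U)
    {H : Set C2} (hH : H ⊆ f.source) (hHf : ∀ x ∈ H, f x ∈ H) (hHU : H ⊆ U) (hHW : H ⊆ W)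
    {x : C2} (hx : x ∈ H) (n : ℕ) : ∀ w : eigenline f lam,
    ∃ v, fderiv ℂ f^[n] x (graphDeriv φ (πc x) v) = graphDeriv φ (πc (f^[n] x)) w := by
  induction n with
  | zero => intro w; exact ⟨w, by simp [Function.iterate_zero]⟩
  | succ n ih =>
    intro w
    obtain ⟨hmem, -, hcomp⟩ := iterate_mem_and_fderiv_iterate_succ hf hH hHf hx n
    rw [Function.iterate_succ_apply'] at *
    obtain ⟨w', hw'⟩ := G.exists_fderiv_graphDeriv_eq hf hU (hHW hmem) (hH hmem)
      (hHU (hHf _ hmem)) w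
    obtain ⟨v, hv⟩ := ih w'
    exact ⟨v, by rw [hcomp, ContinuousLinearMap.comp_apply, hv, hw']⟩

/-- Near a point of the manifold, secants are close to the tangent plane. -/
lemma eventually_norm_sub_graphDeriv_le (hU : IsOpen U) {z : C2} (hz : z ∈ W) {ε : ℝ}
    (hε : 0 < ε) :
    ∀ᶠ x in 𝓝 z, x ∈ W → ‖x - z - graphDeriv φ (πc z) (πc (x - z))‖ ≤ ε * ‖x - z‖ := by
  have hzc := ((G.mem_iff z).1 hz).2.1
  set η := ε / (‖πc‖ + 1) with hη
  have hc := norm_nonneg πc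
  have hη0 : 0 < η := by positivity
  have hηc : η * ‖πc‖ ≤ ε := by
    rw [hη, div_mul_eq_mul_div, div_le_iff₀ (by positivity)]; nlinarith
  have h1 := (G.hasFDerivAt hU hzc).isLittleO.def hη0
  filter_upwards [πc.continuous.continuousAt.eventually h1] with x hx hxW
  have hzs := ((G.mem_iff z).1 hz).2.2
  have hxs := ((G.mem_iff x).1 hxW).2.2
  rw [← hzs, ← hxs, ← map_sub, ← map_sub] at hx
  have h2 : x - z - graphDeriv φ (πc z) (πc (x - z)) =
      ((πs (x - z) - fderiv ℝ φ (πc z) (πc (x - z)) : eigenline f mu) : C2) := by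
    rw [graphDeriv_apply, Submodule.coe_sub]
    conv_lhs => rw [← G.sum (x - z)]
    simp only [map_add, G.c_c, G.c_s, add_zero]
    abel
  rw [h2]
  refine le_trans (b := η * ‖πc (x - z)‖) hx ?_
  calc η * ‖πc (x - z)‖ ≤ η * (‖πc‖ * ‖x - z‖) := by gcongr; exact πc.le_opNorm _
    _ = η * ‖πc‖ * ‖x - z‖ := by ring
    _ ≤ ε * ‖x - z‖ := by gcongr

variable {Ec : C2 → Submodule ℝ C2} {αh : ℝ}

/-- Near the origin, the tangent planes of the manifold are in the neutral cones, because the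
tangent plane at the origin is the neutral eigenline. -/
lemma eventually_graphDeriv_mem_cone (hU : IsOpen U) (h0U : (0 : C2) ∈ U)
    (hEc : ContinuousOn (fun x => (Ec x).starProjection) U)
    (hEc0 : Ec 0 = (eigenline f lam).restrictScalars ℝ) (hα : 0 < αh ∧ αh < Real.pi / 2) :
    ∀ᶠ x in 𝓝 (0 : C2), ∀ v, graphDeriv φ (πc x) v ∈ cone (Ec x) αh := by
  let ι : eigenline f lam →L[ℝ] C2 := (eigenline f lam).subtypeL.restrictScalars ℝ
  have hcos1 : Real.cos αh < 1 := by
    rw [← Real.cos_zero]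
    exact Real.cos_lt_cos_of_nonneg_of_le_pi_div_two le_rfl hα.2.le hα.1
  have hcos0 : 0 ≤ Real.cos αh := Real.cos_nonneg_of_mem_Icc ⟨by linarith [hα.1], hα.2.le⟩
  set ε := (1 - Real.cos αh) / 2 with hε
  have hε0 : 0 < ε := by linarith
  have hJ0 : graphDeriv φ (πc 0) = ι := by
    ext1 v
    rw [graphDeriv_apply, map_zero, G.fderiv_zero]
    simp [ι]
  have hπ0 : ((Ec 0).starProjection).comp ι = ι := by
    ext1 v
    have hv : (v : C2) ∈ Ec 0 := by rw [hEc0]; exact v.2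
    exact Submodule.starProjection_eq_self_iff.2 hv
  have hJ : ContinuousAt (fun x => graphDeriv φ (πc x)) 0 :=
    G.continuousAt_graphDeriv hU (by simpa using h0U)
  have hE : ContinuousAt (fun x => (Ec x).starProjection) 0 :=
    hEc.continuousAt (hU.mem_nhds h0U)
  have h1 : ∀ᶠ x in 𝓝 (0 : C2), ‖graphDeriv φ (πc x) - ι‖ < ε := by
    have hJ' := hJ.tendsto
    rw [hJ0] at hJ'
    filter_upwards [hJ'.eventually (Metric.ball_mem_nhds ι hε0)] with x hx
    exact lt_of_eq_of_lt (dist_eq_norm (graphDeriv φ (πc x)) ι).symm hx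
  have h2 : ∀ᶠ x in 𝓝 (0 : C2), ‖((Ec x).starProjection).comp (graphDeriv φ (πc x)) - ι‖ < ε := by
    have hJ' := (hE.clm_comp hJ).tendsto
    rw [hJ0, hπ0] at hJ'
    filter_upwards [hJ'.eventually (Metric.ball_mem_nhds ι hε0)] with x hx
    exact lt_of_eq_of_lt
      (dist_eq_norm (((Ec x).starProjection).comp (graphDeriv φ (πc x))) ι).symm hx
  filter_upwards [h1, h2] with x h1 h2 v
  have hι : ‖ι v‖ = ‖v‖ := rfl
  have e1 := ((graphDeriv φ (πc x) - ι).le_opNorm v).trans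
    (mul_le_mul_of_nonneg_right h1.le (norm_nonneg v))
  have e2 := ((((Ec x).starProjection).comp (graphDeriv φ (πc x)) - ι).le_opNorm v).trans
    (mul_le_mul_of_nonneg_right h2.le (norm_nonneg v))
  have e3 := norm_add_le ((graphDeriv φ (πc x) - ι) v) (ι v)
  have e4 := norm_sub_le ((Ec x).starProjection (graphDeriv φ (πc x) v))
    ((((Ec x).starProjection).comp (graphDeriv φ (πc x)) - ι) v)
  simp only [sub_apply, ContinuousLinearMap.comp_apply, sub_add_cancel,
    sub_sub_cancel] at e1 e2 e3 e4
  change Real.cos αh * ‖graphDeriv φ (πc x) v‖ ≤ ‖(Ec x).starProjection (graphDeriv φ (πc x) v)‖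
  have e5 : ‖graphDeriv φ (πc x) v‖ ≤ (1 + ε) * ‖v‖ := by rw [hι] at e3; linarith
  have e6 : (1 - ε) * ‖v‖ ≤ ‖(Ec x).starProjection (graphDeriv φ (πc x) v)‖ := by
    rw [hι] at e4; linarith
  have e7 := mul_le_mul_of_nonneg_left e5 hcos0
  have e8 : Real.cos αh * (1 + ε) ≤ 1 - ε := by rw [hε]; nlinarith
  have e9 := mul_le_mul_of_nonneg_right e8 (norm_nonneg v)
  linarith

/-- At all points of the closure of the petals the tangent plane of the manifold is in the neutral
cone: this is true near the origin, hence on the far past of each orbit of the petals, the neutral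
cones are forward invariant, and the condition is closed. -/
lemma graphDeriv_mem_cone (hf : IsSemiParabolicGerm f p q lam mu) {B : Set C2} (hBs : B ⊆ f.source)
    (hU : IsOpen U) (h0U : (0 : C2) ∈ U)
    (hEc : ContinuousOn (fun x => (Ec x).starProjection) U)
    (hEc0 : Ec 0 = (eigenline f lam).restrictScalars ℝ) (hα : 0 < αh ∧ αh < Real.pi / 2)
    (hPU : closure (maximalPetals f B) ⊆ U) (hPW : closure (maximalPetals f B) ⊆ W)
    (hcone : ∀ x ∈ closure (maximalPetals f B),
      fderiv ℂ f x '' cone (Ec x) αh ⊆ interior (cone (Ec (f x)) αh) ∪ {0})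
    {z : C2} (hz : z ∈ closure (maximalPetals f B)) (v : eigenline f lam) :
    graphDeriv φ (πc z) v ∈ cone (Ec z) αh := by
  set P := maximalPetals f B with hP
  have hmain : ∀ x ∈ P, ∀ v, graphDeriv φ (πc x) v ∈ cone (Ec x) αh := by
    intro x hx
    obtain ⟨u, hu0, hu, huP, -, hbot⟩ :=
      exists_orbit_of_mem_maximalPetals hBs hf.zero_mem hf.map_zero hx
    have hstep : ∀ n, (∀ v, graphDeriv φ (πc (u n)) v ∈ cone (Ec (u n)) αh) →
        ∀ v, graphDeriv φ (πc (u (n + 1))) v ∈ cone (Ec (u (n + 1))) αh := by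
      intro n hn w
      have hfu : f (u n) ∈ U := by rw [hu]; exact hPU (subset_closure (huP _))
      obtain ⟨v, hv⟩ := G.exists_fderiv_graphDeriv_eq hf hU (hPW (subset_closure (huP n)))
        (hBs (maximalPetals_subset_homoclinicSet (huP n)).1) hfu w
      rw [hu] at hv
      rw [← hv]
      have := hcone _ (subset_closure (huP n)) ⟨_, hn v, rfl⟩
      rw [hu] at this
      exact interior_cone_union_subset _ _ this
    obtain ⟨N, hN⟩ := eventually_atBot.1
      (hbot.eventually (G.eventually_graphDeriv_mem_cone hU h0U hEc hEc0 hα))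
    have hfor : ∀ k : ℕ, ∀ v, graphDeriv φ (πc (u (min N 0 + k))) v ∈
        cone (Ec (u (min N 0 + k))) αh := by
      intro k
      induction k with
      | zero => simpa using hN (min N 0) (min_le_left _ _)
      | succ k ih =>
        have := hstep _ ih
        rwa [add_assoc] at this
    have h0 := hfor (min N 0).natAbs
    rwa [Int.ofNat_natAbs_of_nonpos (min_le_right _ _), add_neg_cancel, hu0] at h0
  have hzU := hPU hz
  have hJ := G.continuousAt_graphDeriv hU ((G.mem_iff z).1 (hPW hz)).2.1
  have hE : ContinuousAt (fun x => (Ec x).starProjection) z := hEc.continuousAt (hU.mem_nhds hzU)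
  have hJv : ContinuousAt (fun x => graphDeriv φ (πc x) v) z := hJ.clm_apply continuousAt_const
  have : (𝓝[P] z).NeBot := mem_closure_iff_nhdsWithin_neBot.1 hz
  refine le_of_tendsto_of_tendsto (b := 𝓝[P] z)
    ((hJv.norm.const_mul (Real.cos αh)).tendsto.mono_left nhdsWithin_le_nhds)
    ((hE.clm_apply hJv).norm.tendsto.mono_left nhdsWithin_le_nhds) ?_
  filter_upwards [self_mem_nhdsWithin] with x hx using hmain x hx v

end IsCenterGraph

end Tangent

/-! ### Hyperbolic fixed points -/

section Hyperbolic

variable {f : OpenPartialHomeomorph C2 C2} {p : ℤ} {q : ℕ} {lam mu : ℂ}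

lemma symm_iterate_iterate {H : Set C2} (hH : H ⊆ f.source) (hHf : ∀ x ∈ H, f x ∈ H) (n : ℕ) :
    ∀ x ∈ H, f.symm^[n] (f^[n] x) = x := by
  induction n with
  | zero => intro x _; rfl
  | succ n ih =>
    intro x hx
    rw [Function.iterate_succ_apply f, Function.iterate_succ_apply', ih _ (hHf x hx),
      f.left_inv (hH hx)]

lemma continuousAt_symm_iterate {H : Set C2} (hH : H ⊆ f.target) (hHf : ∀ x ∈ H, f.symm x ∈ H)
    {x : C2} (hx : x ∈ H) (n : ℕ) : f.symm^[n] x ∈ H ∧ ContinuousAt f.symm^[n] x := by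
  induction n with
  | zero => exact ⟨hx, continuousAt_id⟩
  | succ n ih =>
    rw [Function.iterate_succ_apply', Function.iterate_succ']
    exact ⟨hHf _ ih.1, ContinuousAt.comp (f.continuousAt_symm (hH ih.1)) ih.2⟩

lemma symm_iterate_orbit {u : ℤ → C2} (hu : ∀ n, f (u n) = u (n + 1)) (hus : ∀ n, u n ∈ f.source)
    (n : ℕ) : f.symm^[n] (u 0) = u (-n) := by
  induction n with
  | zero => simp
  | succ n ih =>
    have h : f (u (-((n + 1 : ℕ) : ℤ))) = u (-n) := by rw [hu]; congr 1; push_cast; ring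
    rw [Function.iterate_succ_apply', ih, ← h, f.left_inv (hus _)]

/-- If the linear map `A` acts on a plane spanned by tangent vectors `J v` as the multiplication by
`κ`, then maps with derivative `A` at `z` change the distance to `z` by a factor close to `|κ|` at
the points of a surface tangent to this plane. -/
lemma exists_expansion {k : C2 → C2} {A : C2 →L[ℂ] C2} {z : C2} (hkz : k z = z)
    (hk : HasFDerivAt k A z) {κ : ℂ} (hκ : 1 < ‖κ‖) {W : Set C2} {J : C2 → C2}
    (hJ : ∀ v, A (J v) = κ • J v)
    (hW : ∀ ε > 0, ∀ᶠ x in 𝓝 z, x ∈ W → ‖x - z - J (x - z)‖ ≤ ε * ‖x - z‖) :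
    ∃ θ > 1, ∀ᶠ x in 𝓝 z, x ∈ W → θ * dist x z ≤ dist (k x) z := by
  have hA := norm_nonneg A
  set ε := (‖κ‖ - 1) / (2 * (‖κ‖ + ‖A‖ + 1)) with hε
  have hε0 : 0 < ε := div_pos (by linarith) (by linarith)
  have hε1 : ε * (‖κ‖ + ‖A‖ + 1) = (‖κ‖ - 1) / 2 := by
    have : ‖κ‖ + ‖A‖ + 1 ≠ 0 := by linarith
    rw [hε]; field_simp
  refine ⟨(1 + ‖κ‖) / 2, by linarith, ?_⟩
  filter_upwards [hW ε hε0, hk.isLittleO.def hε0] with x hx1 hx2 hxW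
  replace hx1 := hx1 hxW
  rw [hkz] at hx2
  rw [dist_eq_norm, dist_eq_norm]
  set w := x - z
  have h2 : ‖κ • J w‖ ≤ ‖k x - z‖ + ‖A (w - J w)‖ + ‖k x - z - A w‖ := by
    have e : κ • J w = (k x - z) - A (w - J w) - (k x - z - A w) := by rw [map_sub, hJ]; abel
    rw [e]
    exact (norm_sub_le _ _).trans (add_le_add_left (norm_sub_le _ _) _)
  have h3 := (A.le_opNorm (w - J w)).trans (mul_le_mul_of_nonneg_left hx1 hA)
  have h4 : ‖w‖ ≤ ‖w - J w‖ + ‖J w‖ := by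
    simpa using norm_add_le (w - J w) (J w)
  rw [norm_smul] at h2
  have h5 : ‖κ‖ * ((1 - ε) * ‖w‖) ≤ ‖κ‖ * ‖J w‖ :=
    mul_le_mul_of_nonneg_left (by linarith) (norm_nonneg κ)
  have h6 : (‖κ‖ - ε * (‖κ‖ + ‖A‖ + 1)) * ‖w‖ ≤ ‖k x - z‖ := by linarith
  rw [hε1] at h6
  linarith

/-- The closure of the petals contains no hyperbolic fixed point `z` of `f ^ q` if there is a center
manifold. By the contraction in the stable cones there is an eigenvalue of the derivative smaller
than the rates in the neutral cones, and the other eigenvalue has modulus larger than one because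
`z` is not attracting. The manifold, whose tangent planes along the petals lie in the neutral cones,
is then tangent at `z` to the unstable eigenline, and so backward orbits of points of the petals
close to `z` converge to `z` instead of the origin. -/
theorem not_isHyperbolicFixedPoint (hf : IsSemiParabolicGerm f p q lam mu) {B K U W : Set C2}
    (hU : IsOpen U) (hUs : U ⊆ f.source) (hBU : B ⊆ U) (hK : IsPreconnected K) (hKU : K ⊆ U)
    (h0K : (0 : C2) ∈ K) (hPK : closure (maximalPetals f B) ⊆ K)
    (hph : PartiallyHyperbolicOn f lam mu U) (hW : IsLocalCenterManifold f lam mu U W)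
    (hPW : closure (maximalPetals f B) ⊆ W)
    (hH : IsCompletelyInvariant f (closure (maximalPetals f B))) {z : C2}
    (hz : z ∈ closure (maximalPetals f B)) : ¬ IsHyperbolicFixedPoint f^[q] z := by
  rintro ⟨hzz, hev⟩
  have hBs : B ⊆ f.source := hBU.trans hUs
  have h0U := hKU h0K
  have hPU := hPK.trans hKU
  set P := maximalPetals f B with hP
  have hHf : ∀ x ∈ closure P, f x ∈ closure P := fun x hx => hH.2.2.1 ⟨x, hx, rfl⟩
  have hHs : ∀ x ∈ closure P, f.symm x ∈ closure P := fun x hx => hH.2.2.2 ⟨x, hx, rfl⟩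
  set A := fderiv ℂ f^[q] z with hA
  have hd : HasFDerivAt f^[q] A z :=
    (iterate_mem_and_fderiv_iterate_succ hf hH.1 hHf hz q).2.1.hasFDerivAt
  have hdj : ∀ j : ℕ, fderiv ℂ f^[q * j] z = A ^ j := fun j => by
    rw [Function.iterate_mul]; exact (hd.iterate hzz j).fderiv
  have hzj : ∀ j : ℕ, f^[q * j] z = z := fun j => by
    rw [Function.iterate_mul]; exact Function.iterate_fixed hzz j
  obtain ⟨Es, Ec, αv, αh, b, l, g, hEs, hEc, hEs0, hEc0, -, hαv, hαh, ⟨hmu0, hmub, hbl, hl1⟩, hg,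
    hall⟩ := hph
  have hb0 : 0 < b := hmu0.trans hmub
  have hl0 : 0 < l := hb0.trans hbl
  have hall' := fun x (hx : x ∈ closure P) => hall x (hPU hx) (hPU (hHf x hx))
  obtain ⟨c, C, hc, hC, hcC⟩ := exists_metricNorm_bounds hg (hPU hz)
  -- the small eigenvalue
  have hEs0' : Es 0 ≠ ⊥ := by
    obtain ⟨v, hv⟩ := hf.hasEigenvalue_mu.exists_hasEigenvector
    rw [hEs0]
    exact Submodule.ne_bot_iff _ |>.2 ⟨v, hv.1, hv.2⟩
  obtain ⟨w, hw, hw0⟩ := Submodule.exists_mem_ne_zero_of_ne_bot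
    (ne_bot_of_isPreconnected hK (hEs.mono hKU) h0K hEs0' (hPK hz))
  obtain ⟨κ₁, hκ₁, hκ₁b⟩ := exists_eigenvalue_norm_le (A := A) (s := b ^ q) (K := C / c)
    (pow_pos hb0 q) hw0 fun j => by
      obtain ⟨w', -, h1, h2⟩ := exists_preimage_in_stable_cone hf hH.1 hHf hb0.le
        (fun x hx => (hall' x hx).2.1) (fun x hx => (hall' x hx).2.2.2) hz (q * j) w
        (by rw [hzj]; exact mem_cone_of_mem αv hw)
      rw [hdj] at h1
      rw [hzj, pow_mul] at h2
      refine ⟨w', h1, ?_⟩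
      have h3 := (hcC w).1.trans (h2.trans (mul_le_mul_of_nonneg_left (hcC w').2 (by positivity)))
      rw [div_mul_eq_mul_div, le_div_iff₀ hc]
      linarith
  -- the large eigenvalue
  obtain ⟨κ₂, hκ₂, hκ₂1⟩ : ∃ κ, Module.End.HasEigenvalue (deriv2 f^[q] z) κ ∧ 1 < ‖κ‖ := by
    by_contra! hcon
    exact not_isAttractingFixedPoint hf hBs hH hz
      ⟨hzz, fun κ hκ => lt_of_le_of_ne (hcon κ hκ) (hev κ hκ)⟩
  have hne : κ₁ ≠ κ₂ := by
    rintro rfl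
    have hb1 : b ^ q ≤ 1 := pow_le_one₀ hb0.le (by linarith)
    linarith
  have hcompl := isCompl_eigenspace hκ₁ hκ₂ hne
  -- the tangent plane of the manifold at `z` is the unstable eigenline
  obtain ⟨πc, πs, φ, G⟩ := hW.exists_graph hf
  have hcone := fun v => G.graphDeriv_mem_cone hf hBs hU h0U hEc hEc0 hαh hPU hPW
    (fun x hx => (hall' x hx).1) hz v
  have htan : ∀ v, A (graphDeriv φ (πc z) v) = κ₂ • graphDeriv φ (πc z) v := by
    intro v
    refine Module.End.mem_eigenspace_iff.1 (mem_eigenspace_of_slow_growth hcompl (l := l ^ q)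
      (K := metricNorm g z (graphDeriv φ (πc z) v) / c)
      (hκ₁b.trans_lt (pow_lt_pow_left₀ hbl hb0.le hf.q_pos.ne')) fun j => ?_)
    obtain ⟨v', hv'⟩ := G.exists_fderiv_iterate_graphDeriv_eq hf hU hH.1 hHf hPU hPW hz (q * j) v
    have h1 := (iterate_mem_neutral_cone hf hH.1 hHf hl0.le (fun x hx => (hall' x hx).1)
      (fun x hx v hv => ((hall' x hx).2.2.1 v hv).1) hz (hcone v') (q * j)).2
    rw [hv', hzj, pow_mul] at h1
    rw [hdj, hzj] at hv'
    refine ⟨_, hv', ?_⟩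
    rw [le_div_iff₀ hc]
    have h2 := mul_le_mul_of_nonneg_left (hcC (graphDeriv φ (πc z) v')).1
      (pow_nonneg (pow_nonneg hl0.le q) j)
    linarith
  obtain ⟨θ, hθ, hexp⟩ := exists_expansion hzz hd hκ₂1 (J := fun v => graphDeriv φ (πc z) (πc v))
    (fun v => htan _) fun ε hε => G.eventually_norm_sub_graphDeriv_le hU (hPW hz) hε
  -- backward orbits of points of the petals close to `z` converge to `z`
  have hkz : f.symm^[q] z = z := by
    have := symm_iterate_iterate hH.1 hHf q z hz
    rwa [hzz] at this
  have hkc := (continuousAt_symm_iterate hH.2.1 hHs hz q).2.tendsto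
  rw [hkz] at hkc
  obtain ⟨ρ, hρ, hnear⟩ := Metric.eventually_nhds_iff.1 (hkc.eventually hexp)
  have hθ0 : 0 < θ := by linarith
  have hback : ∀ x ∈ P, dist x z < ρ →
      f.symm^[q] x ∈ P ∧ dist (f.symm^[q] x) z ≤ θ⁻¹ * dist x z := by
    intro x hx hxρ
    have hPt := maximalPetals_subset_target hBs hf.map_zero (B := B)
    have hkx := (continuousAt_symm_iterate hPt
      (fun y hy => symm_mem_maximalPetals hBs hf.zero_mem hf.map_zero hy) hx q).1
    refine ⟨hkx, ?_⟩
    have h1 := hnear hxρ (hPW (subset_closure hkx))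
    have h2 : f^[q] (f.symm^[q] x) = x := symm_iterate_iterate (f := f.symm) hPt
      (fun y hy => symm_mem_maximalPetals hBs hf.zero_mem hf.map_zero hy) q x hx
    rw [h2] at h1
    rw [inv_mul_eq_div, le_div_iff₀ hθ0]
    linarith
  obtain ⟨x, hxP, hx⟩ := Metric.mem_closure_iff.1 hz ρ hρ
  rw [dist_comm] at hx
  have hlim := tendsto_iterate_of_contracting (inv_nonneg.2 hθ0.le) (inv_lt_one_of_one_lt₀ hθ)
    hback hxP hx
  obtain ⟨u, hu0, hu, huP, -, hbot⟩ :=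
    exists_orbit_of_mem_maximalPetals hBs hf.zero_mem hf.map_zero hxP
  have hlim0 : Tendsto (fun j => (f.symm^[q])^[j] x) atTop (𝓝 0) := by
    have h1 : (fun j : ℕ => (f.symm^[q])^[j] x) = fun j : ℕ => u (-((q * j : ℕ) : ℤ)) := by
      funext j
      rw [← Function.iterate_mul, ← hu0,
        symm_iterate_orbit hu fun n => hBs (maximalPetals_subset_homoclinicSet (huP n)).1]
    rw [h1]
    refine hbot.comp (tendsto_neg_atTop_atBot.comp (tendsto_natCast_atTop_atTop.comp ?_))
    exact tendsto_id.const_mul_atTop' hf.q_pos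
  have hz0 : z = 0 := tendsto_nhds_unique hlim hlim0
  rw [hz0] at hev
  exact hev 1 (hasEigenvalue_one_iterate hf) (by simp)

end Hyperbolic

end Hedgehog

theorem mainTheorem6
    (f : OpenPartialHomeomorph Hedgehog.C2 Hedgehog.C2) (p : ℤ) (q : ℕ) (lam mu : ℂ)
    (hf : Hedgehog.IsSemiParabolicGerm f p q lam mu)
    (hnu : Hedgehog.HasSemiParabolicMultiplicity f q lam mu 1)
    (R : ℝ) (hR : 0 < R) (B' : Set Hedgehog.C2) (hB'open : IsOpen B')
    (hBB' : Metric.closedBall (0 : Hedgehog.C2) R ⊆ B') (hB'f : B' ⊆ f.source)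
    (hph : Hedgehog.PartiallyHyperbolicOn f lam mu B')
    (P : Set Hedgehog.C2)
    (hP : P = Hedgehog.maximalPetals f (Metric.ball (0 : Hedgehog.C2) R)) :
    -- complete invariance of the closure and of the boundary
    (Hedgehog.IsCompletelyInvariant f (closure P) ∧
      Hedgehog.IsCompletelyInvariant f (frontier P) ∧
      Hedgehog.IsCompletelyInvariant f (closure P \ P)) ∧
    -- connectedness, and compact containment in every local center manifold
    (IsConnected (closure P) ∧ IsCompact (closure P) ∧
      ∀ W : Set Hedgehog.C2, Hedgehog.IsLocalCenterManifold f lam mu B' W → closure P ⊆ W) ∧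
    -- no attracting fixed points in the boundary
    (∀ z ∈ frontier P, ¬ Hedgehog.IsAttractingFixedPoint (f^[q]) z) ∧
    -- no hyperbolic fixed points in the boundary
    ((∃ W : Set Hedgehog.C2, Hedgehog.IsLocalCenterManifold f lam mu B' W) →
      ∀ z ∈ frontier P, ¬ Hedgehog.IsHyperbolicFixedPoint (f^[q]) z) := by
  subst hP
  set B := Metric.ball (0 : Hedgehog.C2) R with hB
  set P := Hedgehog.maximalPetals f B with hP
  have hBB'' : B ⊆ B' := Metric.ball_subset_closedBall.trans hBB'
  have hBs : B ⊆ f.source := hBB''.trans hB'f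
  have hPB : P ⊆ B :=
    Hedgehog.maximalPetals_subset_homoclinicSet.trans Hedgehog.homoclinicSet_subset
  have hPcl : closure P ⊆ Metric.closedBall 0 R :=
    closure_minimal (hPB.trans Metric.ball_subset_closedBall) Metric.isClosed_closedBall
  have hPc : IsCompact (closure P) :=
    (isCompact_closedBall (0 : Hedgehog.C2) R).of_isClosed_subset isClosed_closure hPcl
  have h0 : (0 : Hedgehog.C2) ∈ Metric.closedBall (0 : Hedgehog.C2) R :=
    Metric.mem_closedBall_self hR.le
  have h1 : ∀ x ∈ P, f x ∈ P := fun x hx =>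
    Hedgehog.map_mem_maximalPetals hBs hf.zero_mem hf.map_zero hx
  have h2 : ∀ x ∈ P, f.symm x ∈ P := fun x hx =>
    Hedgehog.symm_mem_maximalPetals hBs hf.zero_mem hf.map_zero hx
  have hinv := Hedgehog.isCompletelyInvariant_closure hPc (hPcl.trans (hBB'.trans hB'f))
    (Hedgehog.maximalPetals_subset_target hBs hf.map_zero) h1 h2
  have hW : ∀ W : Set Hedgehog.C2, Hedgehog.IsLocalCenterManifold f lam mu B' W →
      closure P ⊆ W := by
    intro W hW
    have hPW : P ⊆ W := Hedgehog.maximalPetals_subset_homoclinicSet.trans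
      (Hedgehog.homoclinicSet_subset_of_isLocalCenterManifold hf hB'open (hBB' h0) hBB'' hW)
    obtain ⟨-, -, -, -, -, hcl, -⟩ := hW
    exact fun x hx => hcl ⟨closure_mono hPW hx, hBB' (hPcl hx)⟩
  refine ⟨⟨hinv, Hedgehog.isCompletelyInvariant_frontier hinv h1 h2,
    hinv.diff (fun x hx _ => h1 x hx) fun x hx _ => h2 x hx⟩,
    ⟨⟨(Hedgehog.maximalPetals_nonempty hf hnu hR).closure,
      Hedgehog.isPreconnected_closure_maximalPetals⟩, hPc, hW⟩,
    fun z hz => Hedgehog.not_isAttractingFixedPoint hf hBs hinv (frontier_subset_closure hz), ?_⟩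
  rintro ⟨W, hWc⟩ z hz
  exact Hedgehog.not_isHyperbolicFixedPoint hf hB'open hB'f hBB''
    (convex_closedBall (0 : Hedgehog.C2) R).isPreconnected hBB' h0 hPcl hph hWc (hW W hWc) hinv
    (frontier_subset_closure hz)
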